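/- Let $d\ge 1$, let $\mathcal A$ be a finite set of at least two actions, and let $0\le\alpha\le d$, $\beta>0$ and $C_\alpha,L,C_\beta,M,\sigma>0$. In a contextual bandit problem with contexts in $\mathbb R^d$, given by a probability density $f$ on $\mathbb R^d$ and reward functions $\eta=(\eta_a)_{a\in\mathcal A}$, $\eta_a:\mathbb R^d\to\mathbb R$, at each step $t=1,2,\dots$ a context $X_t$ is drawn independently from $f$, the agent chooses $A_t\in\mathcal A$, and it receives $Y_t=\eta_{A_t}(X_t)+W_t$, where the $W_t$ are i.i.d. noise variables independent of the contexts. A policy $\pi$ is a measurable rule $A_t=\pi(X_t;X_{1:t-1},Y_{1:t-1})$. With $\eta^*(x)=\max_a\eta_a(x)$, its expected regret over $T$ steps is $$R=\mathbb E\Big[\sum_{t=1}^T\big(\eta^*(X_t)-\eta_{A_t}(X_t)\big)\Big].$$ Let $\mathcal F_B$ be the class of all pairs $(f,\eta)$ such that, for $X\sim f$, - (margin) $\mathbb P\big(0<\eta^*(X)-\eta_a(X)<u\big)\le C_\alpha u^\alpha$ for all $a\in\mathcal A$, $u>0$; - (Lipschitz) $|\eta_a(x)-\eta_a(x')|\le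 L\|x-x'\|$ for all $a\in\mathcal A$, $x,x'\in\mathbb R^d$, with the Euclidean norm; - (tail) $\mathbb P(f(X)\le u)\le C_\beta u^\beta$ for all $u>0$; - (bounded gaps) $\sup_x\big(\eta^*(x)-\min_a\eta_a(x)\big)\le M$. Then there are a noise distribution with mean zero that is subgaussian with parameter $\sigma^2$, i.e. $\mathbb E[e^{\lambda W}]\le e^{\lambda^2\sigma^2/2}$ for all $\lambda\in\mathbb R$, and a constant $c>0$, not depending on $T$ or $\pi$, such that for every $T\ge 1$ $$\inf_\pi\ \sup_{(f,\eta)\in\mathcal F_B}R\ \ge\ c\left(T^{1-\frac{(\alpha+1)\beta}{\alpha+(d+2)\beta}}+T^{1-\beta}\right).$$ In particular, the same lower bound holds for the worst case over all $(f,\eta)\in\mathcal F_B$ and all noise satisfying this subgaussian condition. -/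

import Mathlib

open MeasureTheory ProbabilityTheory
open scoped ENNReal NNReal

namespace ContextualBandit

/-- The space of contexts: `ℝ^d` with the Euclidean norm. -/
abbrev Context (d : ℕ) : Type := EuclideanSpace ℝ (Fin d)

/-- A probability density function on `ℝ^d` with respect to Lebesgue measure. -/
structure Pdf (d : ℕ) where
  toFun : Context d → ℝ
  measurable_toFun : Measurable toFun
  nonneg : ∀ x, 0 ≤ toFun x
  lintegral_eq_one : ∫⁻ x, ENNReal.ofReal (toFun x) = 1

instance (d : ℕ) : CoeFun (Pdf d) (fun _ => Context d → ℝ) := ⟨Pdf.toFun⟩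

/-- The law of a context with probability density function `f`. -/
noncomputable def Pdf.law {d : ℕ} (f : Pdf d) : Measure (Context d) :=
  volume.withDensity (fun x => ENNReal.ofReal (f x))

instance {d : ℕ} (f : Pdf d) : IsProbabilityMeasure f.law :=
  ⟨by simpa [Pdf.law] using f.lintegral_eq_one⟩

section Rewards

variable {d : ℕ} {𝒜 : Type*}

/-- The largest expected reward `η^*(x) = max_a η_a(x)`. -/
noncomputable def bestReward (η : 𝒜 → Context d → ℝ) (x : Context d) : ℝ := ⨆ a, η a x

/-- The suboptimality gap `η^*(x) - η_a(x)`. -/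
noncomputable def gap (η : 𝒜 → Context d → ℝ) (a : 𝒜) (x : Context d) : ℝ :=
  bestReward η x - η a x

/-- Tsybakov margin condition: `P(0 < η^*(X) - η_a(X) < u) ≤ C_α u^α` for all `a` and `u > 0`. -/
def MarginCondition (α Cα : ℝ) (f : Pdf d) (η : 𝒜 → Context d → ℝ) : Prop :=
  ∀ a : 𝒜, ∀ u : ℝ, 0 < u →
    f.law {x | 0 < gap η a x ∧ gap η a x < u} ≤ ENNReal.ofReal (Cα * u ^ α)

/-- Every `η_a` is Lipschitz with constant `L`. -/
def LipschitzRewards (L : ℝ) (η : 𝒜 → Context d → ℝ) : Prop :=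
  ∀ a : 𝒜, ∀ x x' : Context d, |η a x - η a x'| ≤ L * ‖x - x'‖

/-- Tail condition: `P(f(X) ≤ u) ≤ C_β u^β` for all `u > 0`. -/
def TailCondition (β Cβ : ℝ) (f : Pdf d) : Prop :=
  ∀ u : ℝ, 0 < u → f.law {x | f x ≤ u} ≤ ENNReal.ofReal (Cβ * u ^ β)

/-- Bounded gaps: `sup_x (η^*(x) - min_a η_a(x)) ≤ M`. -/
def BoundedGaps (M : ℝ) (η : 𝒜 → Context d → ℝ) : Prop :=
  ∀ x : Context d, bestReward η x - (⨅ a, η a x) ≤ M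

end Rewards

/-- The class of pairs `(f, η)` that satisfy the margin condition, the Lipschitz condition, the
tail condition and the bound on the gaps, with the given constants. -/
def problemClass (d : ℕ) (𝒜 : Type*) (α Cα L β Cβ M : ℝ) :
    Set (Pdf d × (𝒜 → Context d → ℝ)) :=
  {p | MarginCondition α Cα p.1 p.2 ∧ LipschitzRewards L p.2 ∧
    TailCondition β Cβ p.1 ∧ BoundedGaps M p.2}

/-- The noise law is centred and subgaussian with parameter `σ²`:
`E[e^{λ W}] ≤ e^{λ² σ² / 2}` for all real `λ`, the exponential being integrable. -/
def SubgaussianNoise (σ : ℝ≥0) (ν : Measure ℝ) : Prop :=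
  ∫ w, w ∂ν = 0 ∧ HasSubgaussianMGF id (σ ^ 2) ν

/-- A policy. Time is counted from `0`, so `act t x xs ys` is the action chosen for the current
context `x` after `t` steps with contexts `xs` and rewards `ys`. -/
structure Policy (d : ℕ) (𝒜 : Type*) where
  act : (t : ℕ) → Context d → (Fin t → Context d) → (Fin t → ℝ) → 𝒜
  measurableSet_act : ∀ (t : ℕ) (a : 𝒜),
    MeasurableSet {z : Context d × (Fin t → Context d) × (Fin t → ℝ) |
      act t z.1 z.2.1 z.2.2 = a}

section Interaction

variable {d : ℕ} {𝒜 : Type*}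

/-- The sample space: `ω t = (X_t, W_t)` is the context and the noise of step `t`. -/
abbrev Sample (d : ℕ) : Type := ℕ → Context d × ℝ

/-- The rewards of the first `t` steps, `Y_s = η_{A_s}(X_s) + W_s` with
`A_s = π(X_s; X_{<s}, Y_{<s})`. -/
def rewards (π : Policy d 𝒜) (η : 𝒜 → Context d → ℝ) (ω : Sample d) : (t : ℕ) → Fin t → ℝ
  | 0 => Fin.elim0
  | t + 1 =>
    Fin.snoc (α := fun _ => ℝ) (rewards π η ω t)
      (η (π.act t (ω t).1 (fun s : Fin t => (ω s).1) (rewards π η ω t)) (ω t).1 + (ω t).2)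

/-- The action `A_t = π(X_t; X_{<t}, Y_{<t})` of step `t`. -/
def action (π : Policy d 𝒜) (η : 𝒜 → Context d → ℝ) (ω : Sample d) (t : ℕ) : 𝒜 :=
  π.act t (ω t).1 (fun s : Fin t => (ω s).1) (rewards π η ω t)

/-- The joint law of contexts and noise: the `X_t` are i.i.d. with density `f`, the `W_t` are
i.i.d. with law `ν`, and the two sequences are independent. -/
noncomputable def sampleLaw (f : Pdf d) (ν : ProbabilityMeasure ℝ) : Measure (Sample d) :=
  Measure.infinitePi (fun _ : ℕ => f.law.prod (ν : Measure ℝ))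

/-- The expected regret `E[∑_t (η^*(X_t) - η_{A_t}(X_t))]` over `T` steps. The sum is nonnegative,
so the expectation is taken in `[0, ∞]`. -/
noncomputable def expectedRegret (T : ℕ) (ν : ProbabilityMeasure ℝ) (π : Policy d 𝒜)
    (f : Pdf d) (η : 𝒜 → Context d → ℝ) : ℝ≥0∞ :=
  ∫⁻ ω, ENNReal.ofReal (∑ t ∈ Finset.range T, gap η (action π η ω t) (ω t).1) ∂(sampleLaw f ν)

end Interaction

end ContextualBandit

/-! Take Gaussian noise N(0, σ²) and a density made of one large ball, carrying at least half of the
mass, and `m` small balls (cells) of mass `w`. One distinguished action has reward `±ε` on each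
cell, with freely chosen signs, and `0` on the large ball; all other actions have reward `0`. As
long as `T * ε² * w` is small compared with σ², the samples that fall into a cell do not reveal its
sign, so every policy pays `ε` there a fixed fraction of the time, and the regret is of order `T * m
* w * ε`.

The statistical half compares each model with the reference model in which rewards are pure noise.
`lintegral_apply_action` expresses expectations through a likelihood ratio,
`pow_le_lintegral_sqrt_likelihood` bounds the Hellinger affinity of two models that differ on one
cell, `two_point_lower_bound` is Le Cam's argument for one cell and one step, and
`regret_lower_bound_of_signs` averages over all sign patterns as in Assouad's lemma.

The geometric half, `regret_lower_bound_of_cells`, checks membership in the class. The rewards are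
constant on each ball, so the Lipschitz condition only asks that the balls be `2 * ε / L` apart;
margin and tail conditions bound the total mass `m * w` of the cells.

In `exists_regret_lower_bound_of_scale` one has `ε ≍ r`, `w ≍ 1 / (T * r²)`, radius `≍ r` and `m * w
≍ p`. Margin and tail become `p ≤ r^α` and `p ≤ (T * r^(d+2))^(-β)`, and the regret is of order `T *
r * p`. Equality in both constraints gives the first rate; `r = 1`, `p = T^(-β)` gives the second.
-/

namespace ContextualBandit

/-! ### Integrating out one coordinate of an i.i.d. sequence -/

/-- Resampling one coordinate of an i.i.d. sequence does not change its law. -/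
theorem lintegral_infinitePi_update {E : Type*} [MeasurableSpace E] (μ : Measure E)
    [IsProbabilityMeasure μ] (t : ℕ) {G : (ℕ → E) → ℝ≥0∞} (hG : Measurable G) :
    ∫⁻ ω, G ω ∂(Measure.infinitePi fun _ : ℕ => μ) =
      ∫⁻ ω, ∫⁻ z, G (Function.update ω t z) ∂μ ∂(Measure.infinitePi fun _ : ℕ => μ) := by
  have hmeas : Measurable fun q : (ℕ → E) × E => Function.update q.1 t q.2 := by
    refine measurable_pi_iff.2 fun s => ?_
    by_cases h : s = t
    · subst h; simpa using measurable_snd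
    · simp only [Function.update_of_ne h]; fun_prop
  have key : ((Measure.infinitePi fun _ : ℕ => μ).prod μ).map
      (fun q : (ℕ → E) × E => Function.update q.1 t q.2) = Measure.infinitePi fun _ : ℕ => μ := by
    apply Measure.eq_infinitePi
    intro s B hB
    rw [Measure.map_apply hmeas (MeasurableSet.pi s.countable_toSet fun i _ => hB i)]
    -- The preimage of a box is again a box: coordinate `t` of `ω` becomes free and its constraint
    -- passes to `z`.
    have hpre : (fun q : (ℕ → E) × E => Function.update q.1 t q.2) ⁻¹' (Set.pi s B) =
        (Set.pi (s.erase t : Finset ℕ) B) ×ˢ (if t ∈ s then B t else Set.univ) := by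
      ext ⟨ω, z⟩
      simp only [Set.mem_preimage, Set.mem_pi, Finset.mem_coe, Set.mem_prod, Finset.mem_erase]
      constructor
      · intro h
        refine ⟨fun i hi => by simpa [Function.update_of_ne hi.1] using h i hi.2, ?_⟩
        split_ifs with ht
        · simpa using h t ht
        · trivial
      · rintro ⟨h1, h2⟩ i hi
        by_cases hit : i = t
        · subst hit; simpa [hi] using h2
        · simpa [Function.update_of_ne hit] using h1 i ⟨hit, hi⟩
    rw [hpre, Measure.prod_prod, Measure.infinitePi_pi _ (fun i _ => hB i)]
    split_ifs with ht
    · exact Finset.prod_erase_mul s (fun i => μ (B i)) ht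
    · simp [Finset.erase_eq_of_notMem ht]
  conv_lhs => rw [← key]
  have hG' : Measurable fun q : (ℕ → E) × E => G (Function.update q.1 t q.2) := hG.comp hmeas
  rw [lintegral_map hG hmeas, lintegral_prod _ hG'.aemeasurable]

/-! ### Gaussian shifts and their affinity -/

/-- The density of `N(m, v)` with respect to `N(0, v)`. -/
noncomputable def gaussianRatio (v m y : ℝ) : ℝ := Real.exp (m * y / v - m ^ 2 / (2 * v))

theorem measurable_gaussianRatio (v : ℝ) :
    Measurable fun q : ℝ × ℝ => gaussianRatio v q.1 q.2 := by
  unfold gaussianRatio; fun_prop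

theorem gaussianRatio_pos (v m y : ℝ) : 0 < gaussianRatio v m y := Real.exp_pos _

/-- One-dimensional Cameron–Martin formula: it trades a shift of the noise by the expected reward
for a density factor. -/
theorem lintegral_gaussianReal_add {v : ℝ≥0} (hv : v ≠ 0) (m : ℝ) {F : ℝ → ℝ≥0∞}
    (hF : Measurable F) :
    ∫⁻ w, F (m + w) ∂(gaussianReal 0 v) =
      ∫⁻ y, F y * ENNReal.ofReal (gaussianRatio v m y) ∂(gaussianReal 0 v) := by
  have hv' : (v : ℝ) ≠ 0 := by exact_mod_cast hv
  have hρ : Measurable fun y => ENNReal.ofReal (gaussianRatio v m y) :=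
    ((measurable_gaussianRatio v).comp (measurable_const.prodMk measurable_id)).ennreal_ofReal
  have h1 : ∫⁻ w, F (m + w) ∂(gaussianReal 0 v) = ∫⁻ y, F y ∂(gaussianReal m v) := by
    rw [← lintegral_map hF (measurable_const_add m), gaussianReal_map_const_add, zero_add]
  have hFρ : Measurable fun y => F y * ENNReal.ofReal (gaussianRatio v m y) := hF.mul hρ
  rw [h1, gaussianReal_of_var_ne_zero _ hv, gaussianReal_of_var_ne_zero _ hv,
    lintegral_withDensity_eq_lintegral_mul _ (measurable_gaussianPDF _ _) hF,
    lintegral_withDensity_eq_lintegral_mul _ (measurable_gaussianPDF _ _) hFρ]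
  refine lintegral_congr fun y => ?_
  have : gaussianPDF m v y = gaussianPDF 0 v y * ENNReal.ofReal (gaussianRatio v m y) := by
    rw [gaussianPDF, gaussianPDF, ← ENNReal.ofReal_mul (gaussianPDFReal_nonneg _ _ _)]
    congr 1
    rw [gaussianPDFReal, gaussianPDFReal, gaussianRatio, mul_assoc (_)⁻¹, ← Real.exp_add]
    congr 2
    field_simp
    ring
  simp only [Pi.mul_apply, this]
  ring

theorem lintegral_gaussianRatio {v : ℝ≥0} (hv : v ≠ 0) (m : ℝ) :
    ∫⁻ y, ENNReal.ofReal (gaussianRatio v m y) ∂(gaussianReal 0 v) = 1 := by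
  have := lintegral_gaussianReal_add hv m (F := fun _ => 1) measurable_const
  simpa using this.symm

/-- Completing the square: the geometric mean of two Gaussian densities is the density centred at
the midpoint, up to a constant, and that constant is the affinity. -/
theorem sqrt_gaussianRatio_mul {v : ℝ} (hv : v ≠ 0) (m m' y : ℝ) :
    √(gaussianRatio v m y * gaussianRatio v m' y) =
      Real.exp (-(m - m') ^ 2 / (8 * v)) * gaussianRatio v ((m + m') / 2) y := by
  unfold gaussianRatio
  rw [← Real.exp_add, ← Real.exp_add, ← Real.exp_half]
  congr 1
  field_simp
  ring

/-- The Hellinger affinity of two Gaussian laws with the same variance. -/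
theorem lintegral_sqrt_gaussianRatio_mul {v : ℝ≥0} (hv : v ≠ 0) (m m' : ℝ) :
    ∫⁻ y, ENNReal.ofReal (√(gaussianRatio v m y * gaussianRatio v m' y)) ∂(gaussianReal 0 v) =
      ENNReal.ofReal (Real.exp (-(m - m') ^ 2 / (8 * v))) := by
  have hv' : (v : ℝ) ≠ 0 := by exact_mod_cast hv
  simp_rw [sqrt_gaussianRatio_mul hv', ENNReal.ofReal_mul (Real.exp_nonneg _)]
  rw [lintegral_const_mul, lintegral_gaussianRatio hv, mul_one]
  exact ((measurable_gaussianRatio v).comp (measurable_const.prodMk measurable_id)).ennreal_ofReal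

theorem subgaussianNoise_gaussianReal (σ : ℝ≥0) : SubgaussianNoise σ (gaussianReal 0 (σ ^ 2)) := by
  refine ⟨integral_id_gaussianReal, ⟨fun t => integrable_exp_mul_gaussianReal t, fun t => ?_⟩⟩
  rw [mgf_id_gaussianReal]
  simp

/-! ### Measurability along a policy -/

theorem Policy.measurable_apply_act {d : ℕ} {𝒜 β : Type*} [Finite 𝒜] [MeasurableSpace β]
    (π : Policy d 𝒜) {φ : 𝒜 → Context d → β} (hφ : ∀ a, Measurable (φ a)) (t : ℕ) :
    Measurable fun q : Context d × (Fin t → Context d) × (Fin t → ℝ) =>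
      φ (π.act t q.1 q.2.1 q.2.2) q.1 := by
  -- Actions carry no σ-algebra; the discrete one suits the measurability of the sets `act = a`,
  -- since 𝒜 is finite.
  let _ : MeasurableSpace 𝒜 := ⊤
  have h1 : Measurable fun q : Context d × (Fin t → Context d) × (Fin t → ℝ) =>
      π.act t q.1 q.2.1 q.2.2 := measurable_to_countable' fun a => π.measurableSet_act t a
  have h2 : Measurable fun q : 𝒜 × Context d => φ q.1 q.2 :=
    measurable_from_prod_countable_right hφ
  exact h2.comp (h1.prodMk measurable_fst)

theorem measurable_finSnoc {E F : Type*} [MeasurableSpace E] [MeasurableSpace F] {t : ℕ}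
    {u : F → Fin t → E} {z : F → E} (hu : Measurable u) (hz : Measurable z) :
    Measurable fun q => (Fin.snoc (α := fun _ => E) (u q) (z q) : Fin (t + 1) → E) := by
  refine measurable_pi_iff.2 fun s => ?_
  refine Fin.lastCases ?_ (fun i => ?_) s
  · simpa using hz
  · simpa using measurable_pi_iff.1 hu i

/-! ### Histories and likelihood ratios -/

section Likelihood

variable {d : ℕ} {𝒜 : Type*}

/-- The contexts of the first `t` steps. -/
def pastFst (t : ℕ) (ω : Sample d) : Fin t → Context d := fun s => (ω s).1

/-- The noise of the first `t` steps, regarded as rewards in the reference model. -/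
def pastSnd (t : ℕ) (ω : Sample d) : Fin t → ℝ := fun s => (ω s).2

/-- The action of step `t` when the noise variables themselves are shown as rewards. -/
def refAction (π : Policy d 𝒜) (ω : Sample d) (t : ℕ) : 𝒜 :=
  π.act t (ω t).1 (pastFst t ω) (pastSnd t ω)

/-- The likelihood ratio after `t` steps of the model with rewards `η` and noise `N(0, v)` with
respect to the model in which all expected rewards vanish. -/
noncomputable def likelihood (v : ℝ) (π : Policy d 𝒜) (η : 𝒜 → Context d → ℝ) (t : ℕ)
    (ω : Sample d) : ℝ :=
  ∏ s ∈ Finset.range t, gaussianRatio v (η (refAction π ω s) (ω s).1) (ω s).2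

theorem measurable_pastFst (t : ℕ) : Measurable (pastFst (d := d) t) := by
  unfold pastFst; fun_prop

theorem measurable_pastSnd (t : ℕ) : Measurable (pastSnd (d := d) t) := by
  unfold pastSnd; fun_prop

theorem pastFst_update (ω : Sample d) (t : ℕ) (z : Context d × ℝ) :
    pastFst t (Function.update ω t z) = pastFst t ω := by
  funext s; simp [pastFst, Function.update_of_ne s.2.ne]

theorem pastSnd_update (ω : Sample d) (t : ℕ) (z : Context d × ℝ) :
    pastSnd t (Function.update ω t z) = pastSnd t ω := by
  funext s; simp [pastSnd, Function.update_of_ne s.2.ne]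

theorem pastFst_succ_update (ω : Sample d) (t : ℕ) (z : Context d × ℝ) :
    pastFst (t + 1) (Function.update ω t z) =
      Fin.snoc (α := fun _ => Context d) (pastFst t ω) z.1 := by
  funext s
  refine Fin.lastCases ?_ (fun i => ?_) s
  · simp [pastFst]
  · simp [pastFst, Function.update_of_ne i.2.ne]

theorem pastSnd_succ_update (ω : Sample d) (t : ℕ) (z : Context d × ℝ) :
    pastSnd (t + 1) (Function.update ω t z) =
      Fin.snoc (α := fun _ => ℝ) (pastSnd t ω) z.2 := by
  funext s
  refine Fin.lastCases ?_ (fun i => ?_) s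
  · simp [pastSnd]
  · simp [pastSnd, Function.update_of_ne i.2.ne]

/-- Non-anticipation: the history before step `t` ignores the sample of step `t`, so that sample can
be integrated out separately. -/
theorem rewards_congr (π : Policy d 𝒜) (η : 𝒜 → Context d → ℝ) {ω ω' : Sample d} (t : ℕ)
    (h : ∀ s < t, ω s = ω' s) : rewards π η ω t = rewards π η ω' t := by
  induction t with
  | zero => rfl
  | succ t ih =>
    have h1 := ih fun s hs => h s (hs.trans t.lt_succ_self)
    have h2 : (fun s : Fin t => (ω s).1) = fun s : Fin t => (ω' s).1 :=
      funext fun s => by rw [h s (s.2.trans t.lt_succ_self)]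
    simp only [rewards, h1, h2, h t t.lt_succ_self]

theorem rewards_update (π : Policy d 𝒜) (η : 𝒜 → Context d → ℝ) (ω : Sample d) (t : ℕ)
    (z : Context d × ℝ) : rewards π η (Function.update ω t z) t = rewards π η ω t :=
  rewards_congr π η t fun _ hs => Function.update_of_ne hs.ne _ _

theorem rewards_succ_update (π : Policy d 𝒜) (η : 𝒜 → Context d → ℝ) (ω : Sample d) (t : ℕ)
    (z : Context d × ℝ) : rewards π η (Function.update ω t z) (t + 1) =
      Fin.snoc (α := fun _ => ℝ) (rewards π η ω t)
        (η (π.act t z.1 (pastFst t ω) (rewards π η ω t)) z.1 + z.2) := by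
  have h := pastFst_update ω t z
  unfold pastFst at h
  simp only [rewards, rewards_update, h, Function.update_self]
  rfl

theorem refAction_update (π : Policy d 𝒜) (ω : Sample d) (t : ℕ) (z : Context d × ℝ) :
    refAction π (Function.update ω t z) t = π.act t z.1 (pastFst t ω) (pastSnd t ω) := by
  simp [refAction, pastFst_update, pastSnd_update]

theorem refAction_update_of_lt (π : Policy d 𝒜) (ω : Sample d) {s t : ℕ} (hs : s < t)
    (z : Context d × ℝ) : refAction π (Function.update ω t z) s = refAction π ω s := by
  have h1 : pastFst s (Function.update ω t z) = pastFst s ω := by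
    funext i; simp [pastFst, Function.update_of_ne (i.2.trans hs).ne]
  have h2 : pastSnd s (Function.update ω t z) = pastSnd s ω := by
    funext i; simp [pastSnd, Function.update_of_ne (i.2.trans hs).ne]
  simp [refAction, h1, h2, Function.update_of_ne hs.ne]

variable {v : ℝ} {π : Policy d 𝒜} {η η' : 𝒜 → Context d → ℝ}

theorem likelihood_nonneg (t : ℕ) (ω : Sample d) : 0 ≤ likelihood v π η t ω :=
  Finset.prod_nonneg fun _ _ => (gaussianRatio_pos _ _ _).le

theorem likelihood_update (ω : Sample d) (t : ℕ) (z : Context d × ℝ) :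
    likelihood v π η t (Function.update ω t z) = likelihood v π η t ω := by
  refine Finset.prod_congr rfl fun s hs => ?_
  have hs := Finset.mem_range.1 hs
  rw [refAction_update_of_lt π ω hs, Function.update_of_ne hs.ne]

/-- The recursion behind the inductions on time: given the past, one step contributes one Gaussian
factor. -/
theorem likelihood_succ_update (ω : Sample d) (t : ℕ) (z : Context d × ℝ) :
    likelihood v π η (t + 1) (Function.update ω t z) = likelihood v π η t ω *
      gaussianRatio v (η (π.act t z.1 (pastFst t ω) (pastSnd t ω)) z.1) z.2 := by
  rw [← likelihood_update ω t z, likelihood, Finset.prod_range_succ, ← likelihood,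
    refAction_update, Function.update_self]

variable [Finite 𝒜]

theorem measurable_apply_refAction {β : Type*} [MeasurableSpace β] {φ : 𝒜 → Context d → β}
    (hφ : ∀ a, Measurable (φ a)) (t : ℕ) :
    Measurable fun ω : Sample d => φ (refAction π ω t) (ω t).1 := by
  have h : Measurable fun ω : Sample d => ((ω t).1, pastFst t ω, pastSnd t ω) :=
    (measurable_fst.comp (measurable_pi_apply t)).prodMk
      ((measurable_pastFst t).prodMk (measurable_pastSnd t))
  exact (π.measurable_apply_act hφ t).comp h

theorem measurable_likelihood (hη : ∀ a, Measurable (η a)) (t : ℕ) :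
    Measurable (likelihood v π η t) := by
  unfold likelihood
  refine Finset.measurable_fun_prod _ fun s _ => ?_
  exact (measurable_gaussianRatio v).comp
    ((measurable_apply_refAction hη s).prodMk (measurable_snd.comp (measurable_pi_apply s)))

theorem measurable_rewards (hη : ∀ a, Measurable (η a)) (t : ℕ) :
    Measurable fun ω : Sample d => rewards π η ω t := by
  induction t with
  | zero => exact measurable_const
  | succ t ih =>
    have h : Measurable fun ω : Sample d => ((ω t).1, pastFst t ω, rewards π η ω t) :=
      (measurable_fst.comp (measurable_pi_apply t)).prodMk ((measurable_pastFst t).prodMk ih)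
    exact measurable_finSnoc ih (((π.measurable_apply_act hη t).comp h).add
      (measurable_snd.comp (measurable_pi_apply t)))

theorem measurable_apply_action {β : Type*} [MeasurableSpace β] {φ : 𝒜 → Context d → β}
    (hφ : ∀ a, Measurable (φ a)) (hη : ∀ a, Measurable (η a)) (t : ℕ) :
    Measurable fun ω : Sample d => φ (action π η ω t) (ω t).1 := by
  have h : Measurable fun ω : Sample d => ((ω t).1, pastFst t ω, rewards π η ω t) :=
    (measurable_fst.comp (measurable_pi_apply t)).prodMk
      ((measurable_pastFst t).prodMk (measurable_rewards hη t))
  exact (π.measurable_apply_act hφ t).comp h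

end Likelihood

/-! ### Change of measure to the pure-noise model -/

section ChangeOfMeasure

variable {d : ℕ} {𝒜 : Type*} [Finite 𝒜] {π : Policy d 𝒜} {η : 𝒜 → Context d → ℝ}

theorem lintegral_sampleLaw_update (f : Pdf d) (ν : ProbabilityMeasure ℝ) (t : ℕ)
    {G : Sample d → ℝ≥0∞} (hG : Measurable G) :
    ∫⁻ ω, G ω ∂(sampleLaw f ν) =
      ∫⁻ ω, ∫⁻ x, ∫⁻ y, G (Function.update ω t (x, y)) ∂(ν : Measure ℝ) ∂f.law
        ∂(sampleLaw f ν) := by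
  rw [sampleLaw, lintegral_infinitePi_update _ t hG]
  refine lintegral_congr fun ω => ?_
  have h : Measurable fun z : Context d × ℝ => G (Function.update ω t z) :=
    hG.comp (measurable_update ω)
  exact lintegral_prod _ h.aemeasurable

/-- The centred Gaussian law as a noise distribution. -/
noncomputable def gaussianNoise (v : ℝ≥0) : ProbabilityMeasure ℝ :=
  ⟨gaussianReal 0 v, inferInstance⟩

/-- The law of contexts and rewards has density `likelihood` with respect to the model in which
the rewards are pure noise. -/
theorem lintegral_rewards (f : Pdf d) {v : ℝ≥0} (hv : v ≠ 0) (hη : ∀ a, Measurable (η a)) (t : ℕ)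
    {F : (Fin t → Context d) × (Fin t → ℝ) → ℝ≥0∞} (hF : Measurable F) :
    ∫⁻ ω, F (pastFst t ω, rewards π η ω t) ∂(sampleLaw f (gaussianNoise v)) =
      ∫⁻ ω, F (pastFst t ω, pastSnd t ω) * ENNReal.ofReal (likelihood v π η t ω)
        ∂(sampleLaw f (gaussianNoise v)) := by
  induction t with
  | zero =>
    refine lintegral_congr fun ω => ?_
    have : rewards π η ω 0 = pastSnd 0 ω := Subsingleton.elim _ _
    simp [likelihood, this]
  | succ t ih =>
    -- `F'` plays the role of the conditional expectation of `F` given the first `t` steps, with the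
    -- last reward already rewritten as noise times a density. The induction hypothesis then applies
    -- to `F'`.
    set F' : (Fin t → Context d) × (Fin t → ℝ) → ℝ≥0∞ := fun h => ∫⁻ x, ∫⁻ y,
      F (Fin.snoc (α := fun _ => Context d) h.1 x, Fin.snoc (α := fun _ => ℝ) h.2 y) *
        ENNReal.ofReal (gaussianRatio v (η (π.act t x h.1 h.2) x) y)
        ∂(gaussianReal 0 v) ∂f.law with hF'
    have hint : Measurable fun q : (((Fin t → Context d) × (Fin t → ℝ)) × Context d) × ℝ =>
        F (Fin.snoc (α := fun _ => Context d) q.1.1.1 q.1.2,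
          Fin.snoc (α := fun _ => ℝ) q.1.1.2 q.2) *
        ENNReal.ofReal (gaussianRatio v (η (π.act t q.1.2 q.1.1.1 q.1.1.2) q.1.2) q.2) := by
      refine (hF.comp ((measurable_finSnoc (by fun_prop) (by fun_prop)).prodMk
        (measurable_finSnoc (by fun_prop) (by fun_prop)))).mul (Measurable.ennreal_ofReal ?_)
      have h : Measurable fun q : (((Fin t → Context d) × (Fin t → ℝ)) × Context d) × ℝ =>
        (q.1.2, q.1.1.1, q.1.1.2) := by fun_prop
      exact (measurable_gaussianRatio v).comp
        (((π.measurable_apply_act hη t).comp h).prodMk measurable_snd)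
    have hF'm : Measurable F' :=
      (Measurable.lintegral_prod_right' (Measurable.lintegral_prod_right' hint))
    have hL : Measurable fun ω : Sample d => F (pastFst (t + 1) ω, rewards π η ω (t + 1)) :=
      hF.comp ((measurable_pastFst _).prodMk (measurable_rewards hη _))
    have hR : Measurable fun ω : Sample d => F (pastFst (t + 1) ω, pastSnd (t + 1) ω) *
        ENNReal.ofReal (likelihood v π η (t + 1) ω) :=
      (hF.comp ((measurable_pastFst _).prodMk (measurable_pastSnd _))).mul
        (measurable_likelihood hη _).ennreal_ofReal
    have hsec : ∀ (h : (Fin t → Context d) × (Fin t → ℝ)) (x : Context d), Measurable fun y : ℝ =>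
        F (Fin.snoc (α := fun _ => Context d) h.1 x, Fin.snoc (α := fun _ => ℝ) h.2 y) :=
      fun h x => hF.comp (measurable_const.prodMk
        (measurable_finSnoc measurable_const measurable_id))
    have e1 : ∫⁻ ω, F (pastFst (t + 1) ω, rewards π η ω (t + 1))
        ∂(sampleLaw f (gaussianNoise v)) =
        ∫⁻ ω, F' (pastFst t ω, rewards π η ω t) ∂(sampleLaw f (gaussianNoise v)) := by
      rw [lintegral_sampleLaw_update f _ t hL]
      refine lintegral_congr fun ω => lintegral_congr fun x => ?_
      simp only [pastFst_succ_update, rewards_succ_update]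
      exact lintegral_gaussianReal_add hv _ (hsec (pastFst t ω, rewards π η ω t) x)
    rw [e1, ih hF'm, lintegral_sampleLaw_update f _ t hR]
    refine lintegral_congr fun ω => ?_
    have h1 := hint.comp (g := _) (f := fun q : Context d × ℝ =>
      (((pastFst t ω, pastSnd t ω), q.1), q.2)) (by fun_prop)
    have h2 : Measurable fun x : Context d => ∫⁻ y,
        F (Fin.snoc (α := fun _ => Context d) (pastFst t ω) x,
          Fin.snoc (α := fun _ => ℝ) (pastSnd t ω) y) *
        ENNReal.ofReal (gaussianRatio v (η (π.act t x (pastFst t ω) (pastSnd t ω)) x) y)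
        ∂(gaussianReal 0 v) := Measurable.lintegral_prod_right' h1
    rw [hF', ← lintegral_mul_const _ h2]
    refine lintegral_congr fun x => ?_
    have h3 : Measurable fun y : ℝ =>
        F (Fin.snoc (α := fun _ => Context d) (pastFst t ω) x,
          Fin.snoc (α := fun _ => ℝ) (pastSnd t ω) y) *
        ENNReal.ofReal (gaussianRatio v (η (π.act t x (pastFst t ω) (pastSnd t ω)) x) y) :=
      h1.comp (measurable_const.prodMk measurable_id)
    rw [← lintegral_mul_const _ h3]
    refine lintegral_congr fun y => ?_
    simp only [pastFst_succ_update, pastSnd_succ_update, likelihood_succ_update]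
    rw [ENNReal.ofReal_mul (likelihood_nonneg _ _)]
    ring

/-- Expectations of functions of the current context and action in terms of the model in which
the rewards are pure noise. -/
theorem lintegral_apply_action (f : Pdf d) {v : ℝ≥0} (hv : v ≠ 0) (hη : ∀ a, Measurable (η a))
    {φ : 𝒜 → Context d → ℝ≥0∞} (hφ : ∀ a, Measurable (φ a)) (t : ℕ) :
    ∫⁻ ω, φ (action π η ω t) (ω t).1 ∂(sampleLaw f (gaussianNoise v)) =
      ∫⁻ ω, φ (refAction π ω t) (ω t).1 * ENNReal.ofReal (likelihood v π η t ω)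
        ∂(sampleLaw f (gaussianNoise v)) := by
  have hint : Measurable fun q : ((Fin t → Context d) × (Fin t → ℝ)) × Context d =>
      φ (π.act t q.2 q.1.1 q.1.2) q.2 := by
    have h : Measurable fun q : ((Fin t → Context d) × (Fin t → ℝ)) × Context d =>
      (q.2, q.1.1, q.1.2) := by fun_prop
    exact (π.measurable_apply_act hφ t).comp h
  have hR : Measurable fun ω : Sample d => φ (refAction π ω t) (ω t).1 *
      ENNReal.ofReal (likelihood v π η t ω) :=
    (measurable_apply_refAction hφ t).mul (measurable_likelihood hη t).ennreal_ofReal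
  rw [lintegral_sampleLaw_update f _ t (measurable_apply_action hφ hη t),
    lintegral_sampleLaw_update f _ t hR]
  have key := lintegral_rewards (π := π) f hv hη t (Measurable.lintegral_prod_right' (ν := f.law) hint)
  calc _ = ∫⁻ ω, ∫⁻ x, φ (π.act t x (pastFst t ω) (rewards π η ω t)) x ∂f.law
        ∂(sampleLaw f (gaussianNoise v)) := by
        refine lintegral_congr fun ω => lintegral_congr fun x => ?_
        have h := fun z => pastFst_update ω t z
        unfold pastFst at h
        simp only [action, rewards_update, h, Function.update_self, lintegral_const,
          measure_univ, mul_one]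
        rfl
    _ = _ := key
    _ = _ := by
        refine lintegral_congr fun ω => ?_
        have h : Measurable fun x : Context d =>
            φ (π.act t x (pastFst t ω) (pastSnd t ω)) x :=
          (π.measurable_apply_act hφ t).comp
            (measurable_id.prodMk measurable_const : Measurable fun x : Context d =>
              (x, pastFst t ω, pastSnd t ω))
        rw [← lintegral_mul_const _ h]
        refine lintegral_congr fun x => ?_
        simp [refAction_update, likelihood_update]

end ChangeOfMeasure

/-! ### Affinity of two models and Le Cam's bound -/

section TwoPoint

variable {d : ℕ} {𝒜 : Type*} [Finite 𝒜] {π : Policy d 𝒜} {η η' : 𝒜 → Context d → ℝ}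

instance (f : Pdf d) (ν : ProbabilityMeasure ℝ) : IsProbabilityMeasure (sampleLaw f ν) := by
  unfold sampleLaw; infer_instance

theorem lintegral_likelihood (f : Pdf d) {v : ℝ≥0} (hv : v ≠ 0) (hη : ∀ a, Measurable (η a))
    (t : ℕ) :
    ∫⁻ ω, ENNReal.ofReal (likelihood v π η t ω) ∂(sampleLaw f (gaussianNoise v)) = 1 := by
  have h := lintegral_rewards (π := π) f hv hη t (F := fun _ => 1) measurable_const
  simpa using h.symm

/-- Independence of the current context from the past; `hHt` expresses that `H` does not look at
step `t`. -/
theorem lintegral_indicator_mul (f : Pdf d) (ν : ProbabilityMeasure ℝ) {B : Set (Context d)}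
    (hB : MeasurableSet B) (t : ℕ) {H : Sample d → ℝ≥0∞} (hH : Measurable H)
    (hHt : ∀ ω z, H (Function.update ω t z) = H ω) :
    ∫⁻ ω, B.indicator 1 (ω t).1 * H ω ∂(sampleLaw f ν) =
      f.law B * ∫⁻ ω, H ω ∂(sampleLaw f ν) := by
  have hI : Measurable (B.indicator (1 : Context d → ℝ≥0∞)) := measurable_one.indicator hB
  have hm : Measurable fun ω : Sample d => B.indicator 1 (ω t).1 * H ω :=
    (hI.comp (measurable_fst.comp (measurable_pi_apply t))).mul hH
  rw [lintegral_sampleLaw_update f ν t hm, ← lintegral_const_mul _ hH]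
  refine lintegral_congr fun ω => ?_
  simp only [hHt, Function.update_self, lintegral_const, measure_univ, mul_one]
  rw [lintegral_mul_const _ hI, lintegral_indicator_one hB]

/-- From `exp (-g) ≥ 1 - g`, with `g ≤ k` on `B` and `g ≤ 0` elsewhere. It bounds the affinity lost
in a single step. -/
theorem le_lintegral_exp_neg_indicator (μ : Measure (Context d)) [IsProbabilityMeasure μ]
    {B : Set (Context d)} (hB : MeasurableSet B) {w k : ℝ} (hk : 0 ≤ k) (hw0 : 0 ≤ w)
    (hw : μ B = ENNReal.ofReal w) {g : Context d → ℝ}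
    (hg : ∀ᵐ x ∂μ, g x ≤ B.indicator (fun _ => k) x) :
    ENNReal.ofReal (1 - k * w) ≤ ∫⁻ x, ENNReal.ofReal (Real.exp (-g x)) ∂μ := by
  have h1 : (1 : ℝ≥0∞) ≤ ∫⁻ x, ENNReal.ofReal (Real.exp (-g x)) ∂μ + ENNReal.ofReal (k * w) := by
    rw [ENNReal.ofReal_mul hk, ← hw, ← lintegral_indicator_const hB,
      ← lintegral_add_right _ (measurable_const.indicator hB)]
    calc (1 : ℝ≥0∞) = ∫⁻ _, 1 ∂μ := by simp
      _ ≤ _ := by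
        refine lintegral_mono_ae ?_
        filter_upwards [hg] with x h3
        have h2 := Real.add_one_le_exp (-g x)
        by_cases hx : x ∈ B
        · simp only [Set.indicator_of_mem hx] at h3 ⊢
          rw [← ENNReal.ofReal_add (Real.exp_nonneg _) hk, ← ENNReal.ofReal_one]
          exact ENNReal.ofReal_le_ofReal (by linarith)
        · simp only [Set.indicator_of_notMem hx] at h3 ⊢
          rw [add_zero, ← ENNReal.ofReal_one]
          exact ENNReal.ofReal_le_ofReal (by linarith)
  rw [ENNReal.ofReal_sub _ (mul_nonneg hk hw0), ENNReal.ofReal_one]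
  exact tsub_le_iff_right.2 h1

/-- The affinity tensorizes in spite of adaptivity. Given the past and the context, whichever action
is chosen, the conditional affinity is at least `exp (-k)` on `B` and is `1` off `B`; averaging over
the context leaves a factor of at least `1 - k * w` per step. -/
theorem pow_le_lintegral_sqrt_likelihood (f : Pdf d) {v : ℝ≥0} (hv : v ≠ 0)
    (hη : ∀ a, Measurable (η a)) (hη' : ∀ a, Measurable (η' a)) {B : Set (Context d)}
    (hB : MeasurableSet B) {w k : ℝ} (hk : 0 ≤ k) (hw0 : 0 ≤ w) (hw : f.law B = ENNReal.ofReal w)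
    (h : ∀ᵐ x ∂f.law, ∀ a, (η a x - η' a x) ^ 2 / (8 * v) ≤ B.indicator (fun _ => k) x) (t : ℕ) :
    ENNReal.ofReal (1 - k * w) ^ t ≤
      ∫⁻ ω, ENNReal.ofReal (√(likelihood v π η t ω * likelihood v π η' t ω))
        ∂(sampleLaw f (gaussianNoise v)) := by
  have hm : ∀ t, Measurable fun ω : Sample d =>
      ENNReal.ofReal (√(likelihood v π η t ω * likelihood v π η' t ω)) := fun t =>
    ((measurable_likelihood hη t).mul (measurable_likelihood hη' t)).sqrt.ennreal_ofReal
  induction t with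
  | zero => simp [likelihood]
  | succ t ih =>
    rw [lintegral_sampleLaw_update f _ t (hm (t + 1)), pow_succ]
    refine (mul_le_mul_left ih _).trans ?_
    rw [← lintegral_mul_const _ (hm t)]
    refine lintegral_mono fun ω => ?_
    simp only [likelihood_succ_update]
    have hsplit : ∀ x y, ENNReal.ofReal (√(likelihood v π η t ω *
          gaussianRatio v (η (π.act t x (pastFst t ω) (pastSnd t ω)) x) y *
          (likelihood v π η' t ω *
            gaussianRatio v (η' (π.act t x (pastFst t ω) (pastSnd t ω)) x) y))) =
        ENNReal.ofReal (√(likelihood v π η t ω * likelihood v π η' t ω)) *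
          ENNReal.ofReal (√(gaussianRatio v (η (π.act t x (pastFst t ω) (pastSnd t ω)) x) y *
            gaussianRatio v (η' (π.act t x (pastFst t ω) (pastSnd t ω)) x) y)) := by
      intro x y
      rw [← ENNReal.ofReal_mul (Real.sqrt_nonneg _), ← Real.sqrt_mul
        (mul_nonneg (likelihood_nonneg _ _) (likelihood_nonneg _ _)), mul_mul_mul_comm]
    simp only [hsplit]
    have hin : ∀ x, ∫⁻ y, ENNReal.ofReal (√(likelihood v π η t ω * likelihood v π η' t ω)) *
          ENNReal.ofReal (√(gaussianRatio v (η (π.act t x (pastFst t ω) (pastSnd t ω)) x) y *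
            gaussianRatio v (η' (π.act t x (pastFst t ω) (pastSnd t ω)) x) y))
            ∂(gaussianReal 0 v) =
        ENNReal.ofReal (√(likelihood v π η t ω * likelihood v π η' t ω)) *
          ENNReal.ofReal (Real.exp (-((η (π.act t x (pastFst t ω) (pastSnd t ω)) x -
            η' (π.act t x (pastFst t ω) (pastSnd t ω)) x) ^ 2 / (8 * v)))) := by
      intro x
      rw [lintegral_const_mul' _ _ ENNReal.ofReal_ne_top,
        lintegral_sqrt_gaussianRatio_mul hv, neg_div]
    have hin' : ∀ x, ∫⁻ y, ENNReal.ofReal (√(likelihood v π η t ω * likelihood v π η' t ω)) *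
          ENNReal.ofReal (√(gaussianRatio v (η (π.act t x (pastFst t ω) (pastSnd t ω)) x) y *
            gaussianRatio v (η' (π.act t x (pastFst t ω) (pastSnd t ω)) x) y))
            ∂(gaussianNoise v : Measure ℝ) = _ := hin
    simp only [hin']
    rw [lintegral_const_mul' _ _ ENNReal.ofReal_ne_top]
    gcongr
    exact le_lintegral_exp_neg_indicator f.law hB hk hw0 hw (h.mono fun x hx => hx _)

/-- A weighted AM–GM inequality. When an action errs under only one of the two models, this controls
the affinity by that model's likelihood, plus a remainder of total mass `1 / 4`, half of the lower
bound `1 / 2` for the affinity. -/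
theorem sqrt_mul_le_of_nonneg {a b : ℝ} (ha : 0 ≤ a) (hb : 0 ≤ b) :
    √(a * b) ≤ 2 * a + (a + b) / 8 := by
  rw [Real.sqrt_le_left (by positivity)]
  nlinarith [sq_nonneg (17 * a - b)]

/-- Le Cam's two-point bound for the action of step `t`: two models that differ only on a set `B`
of small mass cannot both be handled well on `B`. -/
theorem two_point_lower_bound (f : Pdf d) {v : ℝ≥0} (hv : v ≠ 0)
    (hη : ∀ a, Measurable (η a)) (hη' : ∀ a, Measurable (η' a)) {B : Set (Context d)}
    (hB : MeasurableSet B) {w k : ℝ} (hk : 0 ≤ k) (hw0 : 0 ≤ w) (hw : f.law B = ENNReal.ofReal w)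
    (h : ∀ᵐ x ∂f.law, ∀ a, (η a x - η' a x) ^ 2 / (8 * v) ≤ B.indicator (fun _ => k) x) {t : ℕ}
    (ht : t * (k * w) ≤ 1 / 2) (hkw : k * w ≤ 1)
    {φ φ' : 𝒜 → Context d → ℝ≥0∞} (hφ : ∀ a, Measurable (φ a)) (hφ' : ∀ a, Measurable (φ' a))
    {ε : ℝ} (hε : 0 ≤ ε)
    (hε' : ∀ a, ∀ x ∈ B, ENNReal.ofReal ε ≤ φ a x ∨ ENNReal.ofReal ε ≤ φ' a x) :
    ENNReal.ofReal (ε * w / 8) ≤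
      ∫⁻ ω, φ (action π η ω t) (ω t).1 ∂(sampleLaw f (gaussianNoise v)) +
      ∫⁻ ω, φ' (action π η' ω t) (ω t).1 ∂(sampleLaw f (gaussianNoise v)) := by
  rw [lintegral_apply_action f hv hη hφ, lintegral_apply_action f hv hη' hφ']
  have hΛ := (measurable_likelihood (v := v) (π := π) hη t).ennreal_ofReal
  have hΛ' := (measurable_likelihood (v := v) (π := π) hη' t).ennreal_ofReal
  have hm1 : Measurable fun ω : Sample d => φ (refAction π ω t) (ω t).1 *
      ENNReal.ofReal (likelihood v π η t ω) := (measurable_apply_refAction hφ t).mul hΛ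
  have hm2 : Measurable fun ω : Sample d => φ' (refAction π ω t) (ω t).1 *
      ENNReal.ofReal (likelihood v π η' t ω) := (measurable_apply_refAction hφ' t).mul hΛ'
  rw [← lintegral_add_left hm1]
  set I := ∫⁻ ω, (φ (refAction π ω t) (ω t).1 * ENNReal.ofReal (likelihood v π η t ω) +
    φ' (refAction π ω t) (ω t).1 * ENNReal.ofReal (likelihood v π η' t ω))
      ∂(sampleLaw f (gaussianNoise v)) with hI
  set S : Sample d → ℝ≥0∞ := fun ω =>
    ENNReal.ofReal (√(likelihood v π η t ω * likelihood v π η' t ω)) with hS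
  set D : Sample d → ℝ≥0∞ := fun ω =>
    ENNReal.ofReal ((likelihood v π η t ω + likelihood v π η' t ω) / 8) with hD
  have hSm : Measurable S :=
    ((measurable_likelihood hη t).mul (measurable_likelihood hη' t)).sqrt.ennreal_ofReal
  have hDm : Measurable D :=
    (((measurable_likelihood hη t).add (measurable_likelihood hη' t)).div_const 8).ennreal_ofReal
  have hSint : ENNReal.ofReal (1 / 2) ≤ ∫⁻ ω, S ω ∂(sampleLaw f (gaussianNoise v)) := by
    refine le_trans ?_ (pow_le_lintegral_sqrt_likelihood f hv hη hη' hB hk hw0 hw h t)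
    rw [← ENNReal.ofReal_pow (by linarith)]
    -- Bernoulli: `(1 - k * w) ^ t ≥ 1 - t * k * w ≥ 1 / 2`.
    refine ENNReal.ofReal_le_ofReal ?_
    have := one_add_mul_le_pow (a := -(k * w)) (by linarith) t
    rw [← sub_eq_add_neg] at this
    linarith
  have hDint : ∫⁻ ω, D ω ∂(sampleLaw f (gaussianNoise v)) = ENNReal.ofReal (1 / 4) := by
    have : ∀ ω, D ω = ENNReal.ofReal (1 / 8) * (ENNReal.ofReal (likelihood v π η t ω) +
        ENNReal.ofReal (likelihood v π η' t ω)) := fun ω => by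
      rw [← ENNReal.ofReal_add (likelihood_nonneg _ _) (likelihood_nonneg _ _),
        ← ENNReal.ofReal_mul (by norm_num), hD]
      simp only []
      congr 1
      ring
    simp_rw [this]
    rw [lintegral_const_mul' _ _ ENNReal.ofReal_ne_top, lintegral_add_left hΛ, lintegral_likelihood f hv hη,
      lintegral_likelihood f hv hη', ← ENNReal.ofReal_one, ← ENNReal.ofReal_add (by norm_num)
      (by norm_num), ← ENNReal.ofReal_mul (by norm_num)]
    norm_num
  -- On `B` the reference action, shared by both models, costs `ε` in at least one of them; the
  -- AM–GM bound is applied with that model's likelihood in the leading role.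
  have hpt : ∀ ω : Sample d, ENNReal.ofReal ε * (B.indicator 1 (ω t).1 * S ω) ≤
      2 * (φ (refAction π ω t) (ω t).1 * ENNReal.ofReal (likelihood v π η t ω) +
        φ' (refAction π ω t) (ω t).1 * ENNReal.ofReal (likelihood v π η' t ω)) +
      ENNReal.ofReal ε * (B.indicator 1 (ω t).1 * D ω) := by
    intro ω
    by_cases hx : (ω t).1 ∈ B
    swap
    · simp [hx]
    have l0 := likelihood_nonneg (v := v) (π := π) (η := η) t ω
    have l0' := likelihood_nonneg (v := v) (π := π) (η := η') t ω
    simp only [Set.indicator_of_mem hx, Pi.one_apply, one_mul, hS, hD]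
    have two : (2 : ℝ≥0∞) = ENNReal.ofReal 2 := by simp
    rcases hε' (refAction π ω t) _ hx with h1 | h1
    · have h2 : ENNReal.ofReal (√(likelihood v π η t ω * likelihood v π η' t ω)) ≤
          2 * ENNReal.ofReal (likelihood v π η t ω) +
          ENNReal.ofReal ((likelihood v π η t ω + likelihood v π η' t ω) / 8) := by
        rw [two, ← ENNReal.ofReal_mul (by norm_num), ← ENNReal.ofReal_add (by positivity)
          (by positivity)]
        exact ENNReal.ofReal_le_ofReal (sqrt_mul_le_of_nonneg l0 l0')
      calc _ ≤ ENNReal.ofReal ε * (2 * ENNReal.ofReal (likelihood v π η t ω) +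
            ENNReal.ofReal ((likelihood v π η t ω + likelihood v π η' t ω) / 8)) := by gcongr
        _ = 2 * (ENNReal.ofReal ε * ENNReal.ofReal (likelihood v π η t ω) + 0) +
            ENNReal.ofReal ε *
              ENNReal.ofReal ((likelihood v π η t ω + likelihood v π η' t ω) / 8) := by ring
        _ ≤ _ := by gcongr; exact zero_le
    · have h2 : ENNReal.ofReal (√(likelihood v π η t ω * likelihood v π η' t ω)) ≤
          2 * ENNReal.ofReal (likelihood v π η' t ω) +
          ENNReal.ofReal ((likelihood v π η t ω + likelihood v π η' t ω) / 8) := by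
        rw [two, ← ENNReal.ofReal_mul (by norm_num), ← ENNReal.ofReal_add (by positivity)
          (by positivity), mul_comm (likelihood v π η t ω), add_comm (likelihood v π η t ω)]
        exact ENNReal.ofReal_le_ofReal (sqrt_mul_le_of_nonneg l0' l0)
      calc _ ≤ ENNReal.ofReal ε * (2 * ENNReal.ofReal (likelihood v π η' t ω) +
            ENNReal.ofReal ((likelihood v π η t ω + likelihood v π η' t ω) / 8)) := by gcongr
        _ = 2 * (0 + ENNReal.ofReal ε * ENNReal.ofReal (likelihood v π η' t ω)) +
            ENNReal.ofReal ε *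
              ENNReal.ofReal ((likelihood v π η t ω + likelihood v π η' t ω) / 8) := by ring
        _ ≤ _ := by gcongr; exact zero_le
  have hIB : Measurable fun ω : Sample d => B.indicator (1 : Context d → ℝ≥0∞) (ω t).1 :=
    (measurable_one.indicator hB).comp (measurable_fst.comp (measurable_pi_apply t))
  have hint := lintegral_mono (μ := sampleLaw f (gaussianNoise v)) hpt
  have hDm' : Measurable fun ω : Sample d =>
      ENNReal.ofReal ε * (B.indicator 1 (ω t).1 * D ω) := (hIB.mul hDm).const_mul _
  rw [lintegral_const_mul' _ _ ENNReal.ofReal_ne_top, lintegral_add_right _ hDm',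
    lintegral_const_mul' _ _ ENNReal.ofNat_ne_top,
    lintegral_const_mul' _ _ ENNReal.ofReal_ne_top,
    lintegral_indicator_mul f _ hB t hSm (fun ω z => by simp only [hS, likelihood_update]),
    lintegral_indicator_mul f _ hB t hDm (fun ω z => by simp only [hD, likelihood_update]),
    hDint, hw, ← hI] at hint
  -- Affinity at least `1 / 2` against remainder `1 / 4`: what is left is `ε * w / 4 ≤ 2 * I`.
  have hfin : ENNReal.ofReal (ε * (w * (1 / 2))) ≤ 2 * I + ENNReal.ofReal (ε * (w * (1 / 4))) := by
    rw [ENNReal.ofReal_mul hε, ENNReal.ofReal_mul hw0, ENNReal.ofReal_mul hε,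
      ENNReal.ofReal_mul hw0]
    refine le_trans ?_ hint
    gcongr
  by_cases hItop : I = ∞
  · rw [hItop]; exact le_top
  rw [← ENNReal.ofReal_toReal hItop] at hfin ⊢
  have two : (2 : ℝ≥0∞) = ENNReal.ofReal 2 := by simp
  rw [two, ← ENNReal.ofReal_mul (by norm_num), ← ENNReal.ofReal_add (by positivity)
    (by positivity), ENNReal.ofReal_le_ofReal_iff (by positivity)] at hfin
  exact ENNReal.ofReal_le_ofReal (by linarith)

end TwoPoint

/-! ### Rewards with one nonzero action -/

section SingleArm

variable {d : ℕ} {𝒜 : Type*}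

open Classical in
/-- The rewards that are `g` for one distinguished action and `0` for all others. -/
noncomputable def singleArmReward (a₁ : 𝒜) (g : Context d → ℝ) : 𝒜 → Context d → ℝ :=
  fun a x => if a = a₁ then g x else 0

theorem singleArmReward_self (a₁ : 𝒜) (g : Context d → ℝ) (x : Context d) :
    singleArmReward a₁ g a₁ x = g x := if_pos rfl

theorem singleArmReward_of_ne {a a₁ : 𝒜} (h : a ≠ a₁) (g : Context d → ℝ) (x : Context d) :
    singleArmReward a₁ g a x = 0 := if_neg h

theorem measurable_singleArmReward (a₁ : 𝒜) {g : Context d → ℝ} (hg : Measurable g) (a : 𝒜) :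
    Measurable (singleArmReward a₁ g a) := by
  by_cases h : a = a₁
  · subst h
    rwa [funext (singleArmReward_self a g)]
  · rw [funext (singleArmReward_of_ne h g)]
    exact measurable_const

variable [Nontrivial 𝒜]

theorem bestReward_singleArmReward (a₁ : 𝒜) (g : Context d → ℝ) (x : Context d) :
    bestReward (singleArmReward a₁ g) x = max (g x) 0 := by
  obtain ⟨a₀, h₀⟩ := exists_ne a₁
  have hle : ∀ a, singleArmReward a₁ g a x ≤ max (g x) 0 := fun a => by
    by_cases h : a = a₁
    · subst h; rw [singleArmReward_self]; exact le_max_left _ _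
    · rw [singleArmReward_of_ne h]; exact le_max_right _ _
  have hbdd : BddAbove (Set.range fun a => singleArmReward a₁ g a x) :=
    ⟨_, Set.forall_mem_range.2 hle⟩
  refine le_antisymm (ciSup_le hle) (max_le ?_ ?_)
  · exact (singleArmReward_self a₁ g x).symm.trans_le (le_ciSup hbdd a₁)
  · exact (singleArmReward_of_ne h₀ g x).symm.trans_le (le_ciSup hbdd a₀)

theorem iInf_singleArmReward (a₁ : 𝒜) (g : Context d → ℝ) (x : Context d) :
    ⨅ a, singleArmReward a₁ g a x = min (g x) 0 := by
  obtain ⟨a₀, h₀⟩ := exists_ne a₁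
  have hle : ∀ a, min (g x) 0 ≤ singleArmReward a₁ g a x := fun a => by
    by_cases h : a = a₁
    · subst h; rw [singleArmReward_self]; exact min_le_left _ _
    · rw [singleArmReward_of_ne h]; exact min_le_right _ _
  have hbdd : BddBelow (Set.range fun a => singleArmReward a₁ g a x) :=
    ⟨_, Set.forall_mem_range.2 hle⟩
  refine le_antisymm (le_min ?_ ?_) (le_ciInf hle)
  · exact (ciInf_le hbdd a₁).trans_eq (singleArmReward_self a₁ g x)
  · exact (ciInf_le hbdd a₀).trans_eq (singleArmReward_of_ne h₀ g x)

theorem gap_singleArmReward_self (a₁ : 𝒜) (g : Context d → ℝ) (x : Context d) :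
    gap (singleArmReward a₁ g) a₁ x = max (g x) 0 - g x := by
  rw [gap, bestReward_singleArmReward, singleArmReward_self]

theorem gap_singleArmReward_of_ne {a a₁ : 𝒜} (h : a ≠ a₁) (g : Context d → ℝ) (x : Context d) :
    gap (singleArmReward a₁ g) a x = max (g x) 0 := by
  rw [gap, bestReward_singleArmReward, singleArmReward_of_ne h, sub_zero]

theorem gap_singleArmReward_nonneg (a₁ : 𝒜) (g : Context d → ℝ) (a : 𝒜) (x : Context d) :
    0 ≤ gap (singleArmReward a₁ g) a x := by
  by_cases h : a = a₁
  · subst h; rw [gap_singleArmReward_self]; linarith [le_max_left (g x) 0]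
  · rw [gap_singleArmReward_of_ne h]; exact le_max_right _ _

theorem measurable_gap_singleArmReward (a₁ : 𝒜) {g : Context d → ℝ} (hg : Measurable g) (a : 𝒜) :
    Measurable (gap (singleArmReward a₁ g) a) := by
  by_cases h : a = a₁
  · subst h
    simp_rw [funext fun x => gap_singleArmReward_self a g x]
    fun_prop
  · simp_rw [funext fun x => gap_singleArmReward_of_ne h g x]
    fun_prop

theorem bestReward_sub_iInf_singleArmReward (a₁ : 𝒜) (g : Context d → ℝ) (x : Context d) :
    bestReward (singleArmReward a₁ g) x - (⨅ a, singleArmReward a₁ g a x) = |g x| := by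
  rw [bestReward_singleArmReward, iInf_singleArmReward, max_sub_min_eq_abs, zero_sub, abs_neg]

end SingleArm

/-! ### Averaging over sign patterns -/

section Averaging

variable {d : ℕ} {𝒜 : Type*} [Finite 𝒜] [Nontrivial 𝒜]

/-- Assouad's averaging over sign patterns: if the sign of the reward of one action is free on each
of `m` disjoint sets of mass `w`, then some sign pattern forces a large regret. -/
theorem regret_lower_bound_of_signs (f : Pdf d) {v : ℝ≥0} (hv : v ≠ 0) (π : Policy d 𝒜) (a₁ : 𝒜)
    {m T : ℕ} (hT : 1 ≤ T) {B : Fin m → Set (Context d)} (hB : ∀ j, MeasurableSet (B j))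
    (hdisj : Pairwise fun i j => Disjoint (B i) (B j)) {w ε : ℝ} (hw0 : 0 ≤ w) (hε : 0 ≤ ε)
    (hw : ∀ j, f.law (B j) = ENNReal.ofReal w) (hT' : T * (ε ^ 2 / (2 * v) * w) ≤ 1 / 2)
    {g : (Fin m → Bool) → Context d → ℝ} (hg : ∀ s, Measurable (g s))
    (hgB : ∀ s j, ∀ x ∈ B j, g s x = if s j then ε else -ε)
    (hg0 : ∀ᵐ x ∂f.law, (∃ j, x ∈ B j) ∨ ∀ s, g s x = 0) {V : ℝ≥0∞}
    (hV : ∀ s, expectedRegret T (gaussianNoise v) π f (singleArmReward a₁ (g s)) ≤ V) :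
    ENNReal.ofReal (ε * w / 16 * (T * m)) ≤ V := by
  classical
  set P := sampleLaw f (gaussianNoise v) with hP
  -- The two rewards on a cell differ by `2 * ε`, and `(2 * ε) ^ 2 / (8 * v)` is this `k`.
  set k := ε ^ 2 / (2 * v) with hk
  have hvpos : (0 : ℝ) < v := by exact_mod_cast pos_iff_ne_zero.2 hv
  have hk0 : 0 ≤ k := by positivity
  have hkw : k * w ≤ 1 := by
    have h1 : (1 : ℝ) ≤ T := by exact_mod_cast hT
    nlinarith [mul_nonneg hk0 hw0]
  -- The gap restricted to cell `j`: since the cells are disjoint, summing over `j` never exceeds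
  -- the full gap.
  set φ : (Fin m → Bool) → Fin m → 𝒜 → Context d → ℝ≥0∞ := fun s j a =>
    (B j).indicator fun x => ENNReal.ofReal (gap (singleArmReward a₁ (g s)) a x) with hφ
  have hφm : ∀ s j a, Measurable (φ s j a) := fun s j a =>
    (measurable_gap_singleArmReward a₁ (hg s) a).ennreal_ofReal.indicator (hB j)
  set r : (Fin m → Bool) → ℕ → Fin m → ℝ≥0∞ := fun s t j =>
    ∫⁻ ω, φ s j (action π (singleArmReward a₁ (g s)) ω t) (ω t).1 ∂P with hr
  have hη : ∀ s a, Measurable (singleArmReward a₁ (g s) a) := fun s =>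
    measurable_singleArmReward a₁ (hg s)
  have hlow : ∀ s, ∑ t ∈ Finset.range T, ∑ j, r s t j ≤ V := by
    intro s
    refine le_trans ?_ (hV s)
    have hm : ∀ t j, Measurable fun ω : Sample d =>
        φ s j (action π (singleArmReward a₁ (g s)) ω t) (ω t).1 := fun t j =>
      measurable_apply_action (hφm s j) (hη s) t
    have e : ∑ t ∈ Finset.range T, ∑ j, r s t j = ∫⁻ ω, ∑ t ∈ Finset.range T, ∑ j,
        φ s j (action π (singleArmReward a₁ (g s)) ω t) (ω t).1 ∂P := by
      rw [lintegral_finsetSum _ fun t _ => Finset.measurable_fun_sum _ fun j _ => hm t j]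
      refine Finset.sum_congr rfl fun t _ => ?_
      rw [lintegral_finsetSum _ fun j _ => hm t j]
    rw [e, expectedRegret]
    refine lintegral_mono fun ω => ?_
    rw [ENNReal.ofReal_sum_of_nonneg fun t _ => gap_singleArmReward_nonneg _ _ _ _]
    refine Finset.sum_le_sum fun t _ => ?_
    by_cases hx : ∃ j, (ω t).1 ∈ B j
    · obtain ⟨j, hj⟩ := hx
      rw [Finset.sum_eq_single j]
      · simp [hφ, hj]
      · intro i _ hij
        exact Set.indicator_of_notMem (fun hi => Set.disjoint_left.1 (hdisj hij) hi hj) _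
      · simp
    · push Not at hx
      rw [Finset.sum_eq_zero fun j _ => Set.indicator_of_notMem (hx j) _]
      exact zero_le
  have hpair : ∀ s, ∀ t ∈ Finset.range T, ∀ j, ENNReal.ofReal (ε * w / 8) ≤
      r s t j + r (Function.update s j (!s j)) t j := by
    intro s t ht j
    refine two_point_lower_bound f hv (hη s) (hη _) (hB j) hk0 hw0 (hw j) ?_ ?_ hkw (hφm s j)
      (hφm _ j) hε ?_
    · filter_upwards [hg0] with x hx a
      by_cases ha : a = a₁
      swap
      · simp only [singleArmReward_of_ne ha]
        simpa using Set.indicator_nonneg (fun _ _ => hk0) x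
      subst ha
      simp only [singleArmReward_self]
      by_cases hxj : x ∈ B j
      · rw [Set.indicator_of_mem hxj, hgB _ _ x hxj, hgB _ _ x hxj, Function.update_self, hk]
        apply le_of_eq
        cases s j <;> simp <;> field_simp <;> ring
      · have : g s x = g (Function.update s j (!s j)) x := by
          rcases hx with ⟨i, hi⟩ | hx
          · have hij : i ≠ j := fun h => hxj (h ▸ hi)
            rw [hgB _ _ x hi, hgB _ _ x hi, Function.update_of_ne hij]
          · rw [hx, hx]
        simp [this, hxj]
    · refine le_trans ?_ hT'
      have h1 : (t : ℝ) ≤ T := by exact_mod_cast (Finset.mem_range.1 ht).le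
      exact mul_le_mul_of_nonneg_right h1 (mul_nonneg hk0 hw0)
    · intro a x hx
      simp only [hφ, Set.indicator_of_mem hx]
      have h1 := hgB s j x hx
      have h2 := hgB (Function.update s j (!s j)) j x hx
      rw [Function.update_self] at h2
      by_cases ha : a = a₁
      · subst ha
        rw [gap_singleArmReward_self, gap_singleArmReward_self, h1, h2]
        cases s j
        · left; refine ENNReal.ofReal_le_ofReal ?_; simp [hε]
        · right; refine ENNReal.ofReal_le_ofReal ?_; simp [hε]
      · rw [gap_singleArmReward_of_ne ha, gap_singleArmReward_of_ne ha, h1, h2]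
        cases s j
        · right; refine ENNReal.ofReal_le_ofReal ?_; simp
        · left; refine ENNReal.ofReal_le_ofReal ?_; simp
  have hsum : ∀ t ∈ Finset.range T, ∀ j,
      2 ^ m * ENNReal.ofReal (ε * w / 8) ≤ 2 * ∑ s, r s t j := by
    intro t ht j
    -- Flipping the sign of cell `j` permutes the patterns, so both terms of the two-point bound
    -- have the same sum over `s`.
    have hinv : Function.Involutive fun s : Fin m → Bool => Function.update s j (!s j) := by
      intro s; simp
    have e : ∑ s, r (Function.update s j (!s j)) t j = ∑ s, r s t j :=
      Equiv.sum_comp hinv.toPerm fun s => r s t j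
    calc 2 ^ m * ENNReal.ofReal (ε * w / 8) = ∑ _s : Fin m → Bool, ENNReal.ofReal (ε * w / 8) := by
          simp
      _ ≤ ∑ s, (r s t j + r (Function.update s j (!s j)) t j) :=
          Finset.sum_le_sum fun s _ => hpair s t ht j
      _ = 2 * ∑ s, r s t j := by rw [Finset.sum_add_distrib, e, two_mul]
  have htot : 2 ^ m * (T * m * ENNReal.ofReal (ε * w / 8)) ≤ 2 ^ m * (2 * V) := by
    calc (2 : ℝ≥0∞) ^ m * (T * m * ENNReal.ofReal (ε * w / 8))
        = ∑ t ∈ Finset.range T, ∑ _j : Fin m, 2 ^ m * ENNReal.ofReal (ε * w / 8) := by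
          simp; ring
      _ ≤ ∑ t ∈ Finset.range T, ∑ j, 2 * ∑ s, r s t j :=
          Finset.sum_le_sum fun t ht => Finset.sum_le_sum fun j _ => hsum t ht j
      _ = 2 * ∑ s, ∑ t ∈ Finset.range T, ∑ j, r s t j := by
          simp_rw [← Finset.mul_sum]
          congr 1
          symm
          rw [Finset.sum_comm]
          exact Finset.sum_congr rfl fun t _ => Finset.sum_comm
      _ ≤ 2 * ∑ _s : Fin m → Bool, V := by gcongr with s; exact hlow s
      _ = 2 ^ m * (2 * V) := by simp; ring
  rw [ENNReal.mul_le_mul_iff_right (by simp) (by simp)] at htot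
  have two : (2 : ℝ≥0∞) = ENNReal.ofReal 2 := by simp
  rw [← ENNReal.mul_le_mul_iff_right (a := 2) (by simp) (by simp)]
  refine le_trans (le_of_eq ?_) htot
  rw [two, ← ENNReal.ofReal_mul (by norm_num), ← ENNReal.ofReal_natCast T,
    ← ENNReal.ofReal_natCast m, ← ENNReal.ofReal_mul (by positivity),
    ← ENNReal.ofReal_mul (by positivity)]
  congr 1
  ring

end Averaging

/-! ### Piecewise constant densities and Lipschitz rewards -/

section StepFunction

variable {d : ℕ} {ι : Type*} [Fintype ι] {A : ι → Set (Context d)}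

/-- The step function with value `h i` on the set `A i`. -/
noncomputable def stepFun (A : ι → Set (Context d)) (h : ι → ℝ) (x : Context d) : ℝ :=
  ∑ i, (A i).indicator (fun _ => h i) x

theorem stepFun_of_mem (hdisj : Pairwise fun i j => Disjoint (A i) (A j)) (h : ι → ℝ) {i : ι}
    {x : Context d} (hx : x ∈ A i) : stepFun A h x = h i := by
  classical
  rw [stepFun, Finset.sum_eq_single i]
  · simp [hx]
  · intro j _ hj
    exact Set.indicator_of_notMem (fun hxj => Set.disjoint_left.1 (hdisj hj) hxj hx) _
  · simp

theorem stepFun_of_notMem (h : ι → ℝ) {x : Context d} (hx : ∀ i, x ∉ A i) :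
    stepFun A h x = 0 :=
  Finset.sum_eq_zero fun i _ => Set.indicator_of_notMem (hx i) _

theorem lintegral_ofReal_stepFun (hA : ∀ i, MeasurableSet (A i)) {h : ι → ℝ} (hh : ∀ i, 0 ≤ h i) :
    ∫⁻ x, ENNReal.ofReal (stepFun A h x) = ∑ i, ENNReal.ofReal (h i) * volume (A i) := by
  have e : ∀ x, ENNReal.ofReal (stepFun A h x) =
      ∑ i, (A i).indicator (fun _ => ENNReal.ofReal (h i)) x := by
    intro x
    rw [stepFun, ENNReal.ofReal_sum_of_nonneg fun i _ => Set.indicator_nonneg (fun _ _ => hh i) x]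
    refine Finset.sum_congr rfl fun i _ => ?_
    by_cases hx : x ∈ A i <;> simp [hx]
  simp_rw [e]
  rw [lintegral_finsetSum _ fun i _ => measurable_const.indicator (hA i)]
  exact Finset.sum_congr rfl fun i _ => lintegral_indicator_const (hA i) _

/-- The probability density that is constant on each of finitely many disjoint sets. -/
noncomputable def stepPdf (A : ι → Set (Context d)) (h : ι → ℝ) (hA : ∀ i, MeasurableSet (A i))
    (hh : ∀ i, 0 ≤ h i) (hsum : ∑ i, ENNReal.ofReal (h i) * volume (A i) = 1) : Pdf d where
  toFun := stepFun A h
  measurable_toFun :=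
    Finset.measurable_fun_sum _ fun i _ => measurable_const.indicator (hA i)
  nonneg x := Finset.sum_nonneg fun i _ => Set.indicator_nonneg (fun _ _ => hh i) x
  lintegral_eq_one := by rw [lintegral_ofReal_stepFun hA hh, hsum]

variable {h : ι → ℝ} {hA : ∀ i, MeasurableSet (A i)} {hh : ∀ i, 0 ≤ h i}
  {hsum : ∑ i, ENNReal.ofReal (h i) * volume (A i) = 1}

theorem law_stepPdf_apply (hdisj : Pairwise fun i j => Disjoint (A i) (A j)) (i : ι) :
    (stepPdf A h hA hh hsum).law (A i) = ENNReal.ofReal (h i) * volume (A i) := by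
  rw [Pdf.law, withDensity_apply _ (hA i), ← setLIntegral_const]
  exact setLIntegral_congr_fun (hA i) fun x hx => by
    simp only [stepPdf, stepFun_of_mem hdisj h hx]

theorem ae_mem_stepPdf : ∀ᵐ x ∂(stepPdf A h hA hh hsum).law, ∃ i, x ∈ A i := by
  have hU : MeasurableSet (⋃ i, A i)ᶜ := (MeasurableSet.iUnion hA).compl
  have h0 : (stepPdf A h hA hh hsum).law (⋃ i, A i)ᶜ = 0 := by
    rw [Pdf.law, withDensity_apply _ hU, setLIntegral_congr_fun (g := fun _ => 0) hU]
    · simp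
    · intro x hx
      have hx' : ∀ i, x ∉ A i := by simpa using hx
      simp [stepPdf, stepFun_of_notMem h hx']
  filter_upwards [measure_eq_zero_iff_ae_notMem.1 h0] with x hx
  simpa using hx

/-- Prescribed small values on well separated sets extend to a bounded Lipschitz function. -/
theorem exists_lipschitz_extension {S L ε : ℝ} (hS : 0 < S) (hL : 0 ≤ L) (hε : 0 ≤ ε)
    (hεS : 2 * ε ≤ L * S) (hsep : ∀ i j, i ≠ j → ∀ x ∈ A i, ∀ y ∈ A j, S ≤ dist x y)
    {val : ι → ℝ} (hval : ∀ i, |val i| ≤ ε) :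
    ∃ g : Context d → ℝ, Continuous g ∧ (∀ x y, |g x - g y| ≤ L * ‖x - y‖) ∧
      (∀ x, |g x| ≤ ε) ∧ ∀ i, ∀ x ∈ A i, g x = val i := by
  have hdisj : Pairwise fun i j => Disjoint (A i) (A j) := fun i j hij =>
    Set.disjoint_left.2 fun x hi hj => by
      have := hsep i j hij x hi x hj
      rw [dist_self] at this
      linarith
  have hlip : LipschitzOnWith L.toNNReal (stepFun A val) (⋃ i, A i) := by
    refine LipschitzOnWith.of_dist_le_mul fun x hx y hy => ?_
    obtain ⟨i, hi⟩ := Set.mem_iUnion.1 hx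
    obtain ⟨j, hj⟩ := Set.mem_iUnion.1 hy
    rw [stepFun_of_mem hdisj val hi, stepFun_of_mem hdisj val hj, Real.coe_toNNReal _ hL,
      Real.dist_eq]
    by_cases hij : i = j
    · subst hij
      simpa using mul_nonneg hL dist_nonneg
    -- Values on different sets differ by at most `2 * ε ≤ L * S`, which the separation pays for.
    · have h1 := mul_le_mul_of_nonneg_left (hsep i j hij x hi y hj) hL
      have h2 := abs_sub (val i) (val j)
      linarith [hval i, hval j]
  obtain ⟨g₁, hg₁, heq⟩ := hlip.extend_real
  -- Truncation to `[-ε, ε]` keeps the Lipschitz constant and the prescribed values, and bounds the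
  -- gaps off the sets as well.
  have hg := (hg₁.const_min ε).const_max (-ε)
  refine ⟨_, hg.continuous, fun x y => ?_, fun x => ?_, fun i x hx => ?_⟩
  · have := hg.dist_le_mul x y
    rwa [Real.dist_eq, dist_eq_norm, Real.coe_toNNReal _ hL] at this
  · exact abs_le.2 ⟨le_max_left _ _, max_le (by linarith) (min_le_left _ _)⟩
  · have h1 := abs_le.1 (hval i)
    rw [← heq (Set.mem_iUnion.2 ⟨i, hx⟩), stepFun_of_mem hdisj val hx, min_eq_right h1.2,
      max_eq_right h1.1]

end StepFunction

/-! ### The hard instances -/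

section Cells

variable {d : ℕ}

theorem le_dist_of_mem_ball_smul {e x y : Context d} (he : ‖e‖ = 1) {a b r r' S : ℝ}
    (hx : x ∈ Metric.ball (a • e) r) (hy : y ∈ Metric.ball (b • e) r') (h : r + r' + S ≤ |a - b|) :
    S ≤ dist x y := by
  have h1 : dist (a • e) (b • e) = |a - b| := by
    rw [dist_eq_norm, ← sub_smul, norm_smul, he, mul_one, Real.norm_eq_abs]
  have h2 := dist_triangle4 (a • e) x y (b • e)
  rw [Metric.mem_ball] at hx hy
  rw [dist_comm] at hx
  linarith

/-- A ball of radius `ρ` for the bulk of the mass and, on a line, `m` cells of radius `R`;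
all of them are at distance at least `S` from each other. -/
def cells (e : Context d) (m : ℕ) (R ρ S : ℝ) : Option (Fin m) → Set (Context d)
  | none => Metric.ball ((-(R + ρ + S)) • e) ρ
  | some j => Metric.ball (((j : ℝ) * (2 * R + S)) • e) R

theorem cells_separated {e : Context d} (he : ‖e‖ = 1) {m : ℕ} {R ρ S : ℝ} (hR : 0 ≤ R)
    (hρ : 0 ≤ ρ) (hS : 0 ≤ S) (i j : Option (Fin m)) (hij : i ≠ j) (x : Context d)
    (hx : x ∈ cells e m R ρ S i) (y : Context d) (hy : y ∈ cells e m R ρ S j) : S ≤ dist x y := by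
  have hnn : ∀ j : Fin m, 0 ≤ (j : ℝ) * (2 * R + S) := fun j => by positivity
  cases i with
  | none =>
    cases j with
    | none => exact absurd rfl hij
    | some j =>
      refine le_dist_of_mem_ball_smul he hx hy ?_
      rw [abs_sub_comm, abs_of_nonneg] <;> linarith [hnn j]
  | some i =>
    cases j with
    | none =>
      refine le_dist_of_mem_ball_smul he hx hy ?_
      rw [abs_of_nonneg] <;> linarith [hnn i]
    | some j =>
      refine le_dist_of_mem_ball_smul he hx hy ?_
      -- Distinct integer indices differ by at least `1`, so the centres are at least `2 * R + S`
      -- apart.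
      have hne : (i : ℤ) - (j : ℤ) ≠ 0 := by
        intro h
        exact hij (congrArg some (Fin.ext (by omega)))
      have h1 : (1 : ℝ) ≤ |(i : ℝ) - (j : ℝ)| := by
        have := Int.one_le_abs hne
        exact_mod_cast this
      rw [← sub_mul, abs_mul, abs_of_nonneg (by positivity : 0 ≤ 2 * R + S)]
      nlinarith

theorem cells_measurableSet {e : Context d} {m : ℕ} {R ρ S : ℝ} (i : Option (Fin m)) :
    MeasurableSet (cells e m R ρ S i) := by
  cases i <;> exact measurableSet_ball

/-- The regret forced by `m` cells of mass `w`, with constant density `u` on the cells and gap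
`ε` there. -/
theorem regret_lower_bound_of_cells (hd : 1 ≤ d) {𝒜 : Type*} [Finite 𝒜] [Nontrivial 𝒜]
    {α Cα L β Cβ M : ℝ} {v : ℝ≥0} (hv : v ≠ 0) (hα : 0 ≤ α) (hβ : 0 < β) (hCα : 0 < Cα)
    (hL : 0 < L) (hCβ : 0 < Cβ) {m T : ℕ} (hT : 1 ≤ T) {ε w u U R ρ : ℝ} (hε : 0 < ε)
    (hεM : ε ≤ M) (hw : 0 ≤ w) (hu : 0 < u) (hU : 0 < U) (hR : 0 < R) (hρ : 0 < ρ)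
    (hwu : w = u * volume.real (Metric.ball (0 : Context d) R))
    (hmU : 1 - m * w = U * volume.real (Metric.ball (0 : Context d) ρ))
    (hmargin : m * w ≤ Cα * ε ^ α) (htail : m * w ≤ Cβ * u ^ β) (hbulk : 1 ≤ Cβ * U ^ β)
    (hinfo : T * (ε ^ 2 / (2 * v) * w) ≤ 1 / 2) (π : Policy d 𝒜) :
    ENNReal.ofReal (ε * w / 16 * (T * m)) ≤
      ⨆ p ∈ problemClass d 𝒜 α Cα L β Cβ M, expectedRegret T (gaussianNoise v) π p.1 p.2 := by
  obtain ⟨a₁⟩ : Nonempty 𝒜 := inferInstance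
  set e : Context d := EuclideanSpace.single ⟨0, hd⟩ 1 with he
  have he1 : ‖e‖ = 1 := by simp [he]
  -- The least separation at which an `L`-Lipschitz function can pass from `-ε` to `ε`.
  set S := 2 * ε / L with hS
  have hS0 : 0 < S := by positivity
  have hLS : 2 * ε ≤ L * S := by rw [hS, mul_div_cancel₀ _ hL.ne']
  set A := cells e m R ρ S with hA
  have hAm : ∀ i, MeasurableSet (A i) := cells_measurableSet
  have hsep := cells_separated (m := m) he1 hR.le hρ.le hS0.le
  have hdisj : Pairwise fun i j => Disjoint (A i) (A j) := fun i j hij =>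
    Set.disjoint_left.2 fun x hi hj => by
      have := hsep i j hij x hi x hj
      rw [dist_self] at this
      linarith
  set h : Option (Fin m) → ℝ := fun i => i.elim U fun _ => u with hh
  have hh0 : ∀ i, 0 ≤ h i := by rintro (_ | j) <;> simp [hh, hu.le, hU.le]
  have hvol : ∀ (c : Context d) (q : ℝ), volume (Metric.ball c q) =
      ENNReal.ofReal (volume.real (Metric.ball (0 : Context d) q)) := fun c q => by
    rw [Measure.addHaar_ball_center, measureReal_def, ENNReal.ofReal_toReal measure_ball_lt_top.ne]
  have hcell : ∀ j, ENNReal.ofReal (h (some j)) * volume (A (some j)) = ENNReal.ofReal w :=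
    fun j => by
      have : volume (A (some j)) = _ := hvol _ R
      rw [this, hwu, ENNReal.ofReal_mul hu.le]; rfl
  have hmain : ENNReal.ofReal (h none) * volume (A none) = ENNReal.ofReal (1 - m * w) := by
    have : volume (A none) = _ := hvol _ ρ
    rw [this, hmU, ENNReal.ofReal_mul hU.le]; rfl
  have hmw1 : 0 ≤ 1 - m * w := by rw [hmU]; positivity
  have hsum : ∑ i, ENNReal.ofReal (h i) * volume (A i) = 1 := by
    rw [Fintype.sum_option, hmain]
    simp_rw [hcell]
    rw [Finset.sum_const, Finset.card_univ, Fintype.card_fin, nsmul_eq_mul,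
      ← ENNReal.ofReal_natCast, ← ENNReal.ofReal_mul (by positivity),
      ← ENNReal.ofReal_add hmw1 (by positivity)]
    simp
  set f := stepPdf A h hAm hh0 hsum with hf
  have hfA : ∀ i, ∀ x ∈ A i, f x = h i := fun i x hx => stepFun_of_mem hdisj h hx
  have hlaw : ∀ j, f.law (A (some j)) = ENNReal.ofReal w := fun j => by
    rw [hf, law_stepPdf_apply hdisj, hcell]
  have hae : ∀ᵐ x ∂f.law, ∃ i, x ∈ A i := ae_mem_stepPdf
  have hsmall : ∀ Q : Set (Context d), (∀ᵐ x ∂f.law, x ∈ Q → ∃ j, x ∈ A (some j)) →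
      f.law Q ≤ ENNReal.ofReal (m * w) := fun Q hQ => by
    calc f.law Q ≤ f.law (⋃ j, A (some j)) := measure_mono_ae (by
          filter_upwards [hQ] with x hx hxQ
          exact Set.mem_iUnion.2 (hx hxQ))
      _ ≤ ∑ j, f.law (A (some j)) := measure_iUnion_fintype_le _ _
      _ = ENNReal.ofReal (m * w) := by
          simp_rw [hlaw]
          rw [Finset.sum_const, Finset.card_univ, Fintype.card_fin, nsmul_eq_mul,
            ← ENNReal.ofReal_natCast, ← ENNReal.ofReal_mul (by positivity)]
  set val : (Fin m → Bool) → Option (Fin m) → ℝ := fun s i =>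
    i.elim 0 fun j => if s j then ε else -ε with hval
  have hval' : ∀ s i, |val s i| ≤ ε := by
    rintro s (_ | j)
    · simpa [hval] using hε.le
    · simp only [hval, Option.elim_some]
      split_ifs <;> simp [abs_of_pos hε]
  choose g hgc hgL hgε hgA using fun s =>
    exists_lipschitz_extension hS0 hL.le hε.le hLS hsep (hval' s)
  refine regret_lower_bound_of_signs f hv π a₁ hT (fun j => hAm (some j))
    (fun i j hij => hdisj (by simpa using hij)) hw hε.le hlaw hinfo (fun s => (hgc s).measurable)
    (fun s j x hx => hgA s (some j) x hx) ?_ fun s => ?_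
  · filter_upwards [hae] with x hx
    rcases hx with ⟨_ | j, hx⟩
    · exact Or.inr fun s => hgA s none x hx
    · exact Or.inl ⟨j, hx⟩
  refine le_iSup₂_of_le (f, singleArmReward a₁ (g s)) ⟨?_, ?_, ?_, ?_⟩ le_rfl
  · intro a y hy
    -- Almost surely every gap is `0` or `ε`, and it vanishes on the bulk. Hence the margin
    -- condition only has to be checked for `y > ε`, where the mass of the cells suffices.
    have hgap : ∀ᵐ x ∂f.law, (0 < gap (singleArmReward a₁ (g s)) a x ∧
        gap (singleArmReward a₁ (g s)) a x < y) → (∃ j, x ∈ A (some j)) ∧ ε < y := by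
      filter_upwards [hae] with x hx
      rintro ⟨h1, h2⟩
      rcases hx with ⟨_ | j, hx⟩
      · exfalso
        have hg0 : g s x = 0 := hgA s none x hx
        by_cases ha : a = a₁
        · subst ha; simp [gap_singleArmReward_self, hg0] at h1
        · simp [gap_singleArmReward_of_ne ha, hg0] at h1
      · refine ⟨⟨j, hx⟩, lt_of_le_of_lt ?_ h2⟩
        have hg1 : g s x = if s j then ε else -ε := hgA s (some j) x hx
        by_cases ha : a = a₁
        · subst ha
          rw [gap_singleArmReward_self, hg1] at h1 ⊢
          split_ifs at h1 ⊢ with hs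
          · rw [max_eq_left hε.le] at h1; linarith
          · linarith [le_max_right (-ε) 0]
        · rw [gap_singleArmReward_of_ne ha, hg1] at h1 ⊢
          split_ifs at h1 ⊢ with hs
          · exact le_max_left _ _
          · rw [max_eq_right (by linarith)] at h1; linarith
    rcases le_or_gt y ε with hyε | hyε
    · refine le_trans (le_of_eq ?_) zero_le
      refine measure_eq_zero_iff_ae_notMem.2 ?_
      filter_upwards [hgap] with x hx hxy
      exact absurd (hx hxy).2 (not_lt.2 hyε)
    · refine (hsmall _ (hgap.mono fun x hx hxy => (hx hxy).1)).trans ?_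
      refine ENNReal.ofReal_le_ofReal (hmargin.trans ?_)
      gcongr
  · intro a x x'
    by_cases ha : a = a₁
    · subst ha; simpa only [singleArmReward_self] using hgL s x x'
    · simp only [singleArmReward_of_ne ha, sub_zero, abs_zero]
      positivity
  · intro y hy
    -- Three ranges of `y`: from `U` on, the bound exceeds `1`; below `U`, only cells can have
    -- density at most `y`, and they do so only if `u ≤ y`.
    rcases le_or_gt U y with hUy | hUy
    · refine prob_le_one.trans ?_
      rw [← ENNReal.ofReal_one]
      refine ENNReal.ofReal_le_ofReal (hbulk.trans ?_)
      gcongr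
    have hfy : ∀ᵐ x ∂f.law, f x ≤ y → (∃ j, x ∈ A (some j)) ∧ u ≤ y := by
      filter_upwards [hae] with x hx hxy
      rcases hx with ⟨_ | j, hx⟩
      · exact absurd ((hfA none x hx).symm.trans_le hxy) (not_le.2 hUy)
      · exact ⟨⟨j, hx⟩, (hfA (some j) x hx).symm.trans_le hxy⟩
    rcases le_or_gt u y with huy | huy
    · refine (hsmall _ (hfy.mono fun x hx hxy => (hx hxy).1)).trans ?_
      refine ENNReal.ofReal_le_ofReal (htail.trans ?_)
      gcongr
    · refine le_trans (le_of_eq ?_) zero_le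
      refine measure_eq_zero_iff_ae_notMem.2 ?_
      filter_upwards [hfy] with x hx hxy
      exact absurd (hx hxy).2 (not_le.2 huy)
  · intro x
    rw [bestReward_sub_iInf_singleArmReward]
    exact (hgε s x).trans hεM

end Cells

/-! ### Choice of the parameters -/

theorem exists_pos_pow_le {d : ℕ} (hd : 1 ≤ d) {x : ℝ} (hx : 0 < x) :
    ∃ y : ℝ, 0 < y ∧ y ^ d ≤ x := by
  refine ⟨min 1 x, lt_min one_pos hx, ?_⟩
  calc min 1 x ^ d ≤ min 1 x := by
        simpa using pow_le_pow_of_le_one (lt_min one_pos hx).le (min_le_left 1 x) hd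
    _ ≤ x := min_le_right _ _

/-- For a gap scale `r` and a mass scale `p` that are admissible for the margin condition, the tail
condition and the available information, the regret is at least of order `T * r * p`. -/
theorem exists_regret_lower_bound_of_scale {d : ℕ} (hd : 1 ≤ d) {𝒜 : Type*} [Finite 𝒜]
    [Nontrivial 𝒜] {α Cα L β Cβ M : ℝ} {σ : ℝ≥0} (hα : 0 ≤ α) (hβ : 0 < β) (hCα : 0 < Cα)
    (hL : 0 < L) (hCβ : 0 < Cβ) (hM : 0 < M) (hσ : 0 < σ) :
    ∃ c : ℝ, 0 < c ∧ ∀ (T : ℕ) (r p : ℝ), 1 ≤ T → 0 < r → r ≤ 1 → 0 < p → p ≤ r ^ α →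
      p ≤ (T * r ^ (d + 2)) ^ (-β) → 1 ≤ T * r ^ 2 * p → ∀ π : Policy d 𝒜,
      ENNReal.ofReal (c * (T * r * p)) ≤ ⨆ q ∈ problemClass d 𝒜 α Cα L β Cβ M,
        expectedRegret T (gaussianNoise (σ ^ 2)) π q.1 q.2 := by
  have hσ' : (0 : ℝ) < σ := by exact_mod_cast hσ
  -- The gap will be `κ * r`: `κ ≤ M` bounds the gaps, `κ ≤ σ` limits the information per sample.
  obtain ⟨κ, hκ, hκM, hκσ⟩ : ∃ κ : ℝ, 0 < κ ∧ κ ≤ M ∧ κ ≤ σ :=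
    ⟨min M σ, lt_min hM hσ', min_le_left _ _, min_le_right _ _⟩
  -- The cells will have total mass at most `δ * p`: `1 / 2` keeps half of the mass for the bulk,
  -- the other bound is for the margin condition.
  obtain ⟨δ, hδ, hδ2, hδα⟩ : ∃ δ : ℝ, 0 < δ ∧ δ ≤ 1 / 2 ∧ δ ≤ Cα * κ ^ α :=
    ⟨min (1 / 2) (Cα * κ ^ α), lt_min (by norm_num) (by positivity), min_le_left _ _,
      min_le_right _ _⟩
  set V : ℝ := volume.real (Metric.ball (0 : Context d) 1) with hVdef
  have hV : 0 < V := ENNReal.toReal_pos (Metric.measure_ball_pos _ _ one_pos).ne'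
    measure_ball_lt_top.ne
  have hball : ∀ R : ℝ, 0 < R → volume.real (Metric.ball (0 : Context d) R) = R ^ d * V := by
    intro R hR
    rw [measureReal_def, Measure.addHaar_ball_of_pos _ _ hR, ENNReal.toReal_mul,
      ENNReal.toReal_ofReal (by positivity), finrank_euclideanSpace_fin]
    rfl
  -- Solves `Cβ * K₀ ^ β = δ`; the factor `l` then makes the cells small enough for their density to
  -- be at least `K₀ / (T * r ^ (d + 2))`.
  set K₀ : ℝ := (δ / Cβ) ^ (1 / β) with hK₀
  have hK₀pos : 0 < K₀ := by positivity
  obtain ⟨l, hl, hld⟩ := exists_pos_pow_le hd (x := δ / (V * K₀)) (by positivity)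
  -- Solves `Cβ * U₀ ^ β = 1`; `ρ` is chosen so that half of the mass already gives the bulk density
  -- `U₀`.
  set U₀ : ℝ := (1 / Cβ) ^ (1 / β) with hU₀
  have hU₀pos : 0 < U₀ := by positivity
  obtain ⟨ρ, hρ, hρd⟩ := exists_pos_pow_le hd (x := 1 / (2 * V * U₀)) (by positivity)
  refine ⟨κ * δ / 32, by positivity, fun T r p hT hr hr1 hp hpα hpβ hinf π => ?_⟩
  have hT0 : (0 : ℝ) < T := by exact_mod_cast hT
  have hp1 : p ≤ 1 := hpα.trans (Real.rpow_le_one hr.le hr1 hα)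
  set N : ℝ := T * r ^ 2 * p with hN
  set m : ℕ := ⌊N⌋₊ with hm
  have hmN : (m : ℝ) ≤ N := Nat.floor_le (by positivity)
  -- Rounding down costs at most a factor `2` because `N ≥ 1`.
  have hmN' : N / 2 ≤ m := by
    have h1 := Nat.lt_floor_add_one N
    have h2 : (1 : ℝ) ≤ m := by exact_mod_cast Nat.le_floor (by simpa using hinf)
    linarith
  -- The largest order of mass whose sign stays hidden over `T` steps at gap scale `r`.
  set w : ℝ := δ / (T * r ^ 2) with hw
  have hw0 : 0 < w := by positivity
  have hNw : N * w = δ * p := by rw [hN, hw]; field_simp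
  have hmw : m * w ≤ δ * p := by rw [← hNw]; gcongr
  have hmw' : δ * p / 2 ≤ m * w := by
    rw [← hNw, mul_div_right_comm]; gcongr
  have hmw2 : m * w ≤ 1 / 2 := hmw.trans (by nlinarith)
  have key := regret_lower_bound_of_cells hd (v := σ ^ 2) (pow_ne_zero 2 hσ.ne') hα hβ hCα hL hCβ
    hT (m := m) (ε := κ * r) (w := w) (u := w / ((l * r) ^ d * V))
    (U := (1 - m * w) / (ρ ^ d * V)) (R := l * r) (ρ := ρ) (M := M) (by positivity)
    (by nlinarith) hw0.le (by positivity) (div_pos (by linarith) (by positivity)) (by positivity)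
    hρ (by rw [hball _ (by positivity)]; field_simp) (by rw [hball _ hρ]; field_simp)
    ?_ ?_ ?_ ?_ π
  · refine le_trans (ENNReal.ofReal_le_ofReal ?_) key
    calc κ * δ / 32 * (T * r * p) = κ * r / 16 * T * (δ * p / 2) := by ring
      _ ≤ κ * r / 16 * T * (m * w) := by gcongr
      _ = κ * r * w / 16 * (T * m) := by ring
  · calc m * w ≤ δ * p := hmw
      _ ≤ Cα * κ ^ α * r ^ α := by gcongr
      _ = Cα * (κ * r) ^ α := by rw [Real.mul_rpow hκ.le hr.le, mul_assoc]
  · have h1 : K₀ * (T * r ^ (d + 2))⁻¹ ≤ w / ((l * r) ^ d * V) := by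
      have h2 : l ^ d * (V * K₀) ≤ δ := (le_div_iff₀ (by positivity)).1 hld
      rw [hw, div_div, ← div_eq_mul_inv, div_le_div_iff₀ (by positivity) (by positivity), mul_pow]
      calc K₀ * (T * r ^ 2 * (l ^ d * r ^ d * V)) =
            (l ^ d * (V * K₀)) * (T * r ^ (d + 2)) := by ring
        _ ≤ δ * (T * r ^ (d + 2)) := by gcongr
    calc m * w ≤ δ * p := hmw
      _ = Cβ * (K₀ ^ β * p) := by
          rw [hK₀, ← Real.rpow_mul (by positivity), one_div_mul_cancel hβ.ne', Real.rpow_one]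
          field_simp
      _ ≤ Cβ * (K₀ ^ β * (T * r ^ (d + 2)) ^ (-β)) := by gcongr
      _ = Cβ * (K₀ * (T * r ^ (d + 2))⁻¹) ^ β := by
          rw [Real.mul_rpow hK₀pos.le (by positivity), Real.inv_rpow (by positivity),
            Real.rpow_neg (by positivity)]
      _ ≤ Cβ * (w / ((l * r) ^ d * V)) ^ β := by gcongr
  · have h1 : U₀ ≤ (1 - m * w) / (ρ ^ d * V) := by
      have h2 : ρ ^ d * (2 * V * U₀) ≤ 1 := (le_div_iff₀ (by positivity)).1 hρd
      rw [le_div_iff₀ (by positivity)]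
      linarith
    calc (1 : ℝ) = Cβ * U₀ ^ β := by
          rw [hU₀, ← Real.rpow_mul (by positivity), one_div_mul_cancel hβ.ne', Real.rpow_one]
          field_simp
      _ ≤ _ := by gcongr
  · have e : (T : ℝ) * ((κ * r) ^ 2 / (2 * ((σ ^ 2 : ℝ≥0) : ℝ)) * w) = κ ^ 2 / σ ^ 2 * (δ / 2) := by
      rw [hw]; push_cast; field_simp
    rw [e]
    have h1 : κ ^ 2 / (σ : ℝ) ^ 2 ≤ 1 := by
      rw [div_le_one (by positivity)]; gcongr
    exact (mul_le_mul h1 (by linarith : δ / 2 ≤ 1 / 2) (by positivity) zero_le_one).trans_eq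
      (one_mul _)

end ContextualBandit

/-! ### The two rates -/

theorem theorem2 (d : ℕ) (hd : 1 ≤ d) (𝒜 : Type*) [Finite 𝒜] [Nontrivial 𝒜]
    (α Cα L β Cβ M : ℝ) (σ : ℝ≥0)
    (hα : 0 ≤ α) (hαd : α ≤ d) (hβ : 0 < β)
    (hCα : 0 < Cα) (hL : 0 < L) (hCβ : 0 < Cβ) (hM : 0 < M) (hσ : 0 < σ) :
    ∃ ν : ProbabilityMeasure ℝ, ContextualBandit.SubgaussianNoise σ (ν : Measure ℝ) ∧
      ∃ c : ℝ, 0 < c ∧ ∀ T : ℕ, 1 ≤ T →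
        ENNReal.ofReal (c * ((T : ℝ) ^ (1 - (α + 1) * β / (α + ((d : ℝ) + 2) * β))
            + (T : ℝ) ^ (1 - β))) ≤
          ⨅ π : ContextualBandit.Policy d 𝒜,
            ⨆ p ∈ ContextualBandit.problemClass d 𝒜 α Cα L β Cβ M,
              ContextualBandit.expectedRegret T ν π p.1 p.2 := by
  refine ⟨ContextualBandit.gaussianNoise (σ ^ 2),
    ContextualBandit.subgaussianNoise_gaussianReal σ, ?_⟩
  obtain ⟨c, hc, hbound⟩ := ContextualBandit.exists_regret_lower_bound_of_scale hd (𝒜 := 𝒜)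
    (α := α) hα hβ hCα hL hCβ hM hσ
  refine ⟨c / 2, by positivity, fun T hT => le_iInf fun π => ?_⟩
  have hT1 : (1 : ℝ) ≤ T := by exact_mod_cast hT
  have hT0 : (0 : ℝ) < T := by linarith
  set D : ℝ := α + ((d : ℝ) + 2) * β with hD
  have hDpos : 0 < D := by positivity
  -- With `r = T ^ (-γ)`, this exponent makes `r ^ α` equal to `(T * r ^ (d + 2)) ^ (-β)`.
  set γ : ℝ := β / D with hγ
  have hγD : γ * D = β := div_mul_cancel₀ _ hDpos.ne'
  have hγ0 : 0 < γ := by positivity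
  have hpow : ∀ (n : ℕ) (x : ℝ), ((T : ℝ) ^ x) ^ n = (T : ℝ) ^ (x * n) := fun n x => by
    rw [Real.rpow_mul hT0.le, Real.rpow_natCast]
  have hmul : ∀ x : ℝ, (T : ℝ) * (T : ℝ) ^ x = (T : ℝ) ^ (1 + x) := fun x => by
    rw [Real.rpow_add hT0, Real.rpow_one]
  have h1 := hbound T ((T : ℝ) ^ (-γ)) ((T : ℝ) ^ (-γ * α)) hT (by positivity)
    (Real.rpow_le_one_of_one_le_of_nonpos hT1 (by linarith)) (by positivity)
    (Real.rpow_mul hT0.le _ _).le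
    (by
      rw [hpow, hmul, ← Real.rpow_mul hT0.le]
      refine Real.rpow_le_rpow_of_exponent_le hT1 (le_of_eq ?_)
      push_cast
      rw [hD] at hγD
      linear_combination -hγD)
    (by
      rw [hpow, hmul, ← Real.rpow_add hT0]
      refine Real.one_le_rpow hT1 ?_
      push_cast
      -- Here `α ≤ d` enters: it guarantees room for at least one cell.
      have e : γ * (α + 2) ≤ 1 := by
        rw [hγ, div_mul_eq_mul_div, div_le_one hDpos, hD]
        nlinarith
      linarith) π
  have e1 : (T : ℝ) * (T : ℝ) ^ (-γ) * (T : ℝ) ^ (-γ * α) = (T : ℝ) ^ (1 - (α + 1) * β / D) := by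
    rw [hmul, ← Real.rpow_add hT0]
    congr 1
    rw [hγ]
    ring
  rw [e1] at h1
  have hmain : ∀ x : ℝ, x ≤ (T : ℝ) ^ (1 - (α + 1) * β / D) → ENNReal.ofReal (c * x) ≤
      ⨆ p ∈ ContextualBandit.problemClass d 𝒜 α Cα L β Cβ M,
        ContextualBandit.expectedRegret T (ContextualBandit.gaussianNoise (σ ^ 2)) π p.1 p.2 :=
    fun x hx => (ENNReal.ofReal_le_ofReal (by gcongr)).trans h1
  have h2 : ENNReal.ofReal (c * (T : ℝ) ^ (1 - β)) ≤
      ⨆ p ∈ ContextualBandit.problemClass d 𝒜 α Cα L β Cβ M,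
        ContextualBandit.expectedRegret T (ContextualBandit.gaussianNoise (σ ^ 2)) π p.1 p.2 := by
    -- For `β > 1` the choice `r = 1` leaves no room for a cell, but then `T ^ (1 - β)` is at most
    -- the first rate, whose exponent is nonnegative.
    rcases le_or_gt β 1 with hβ1 | hβ1
    · have h3 := hbound T 1 ((T : ℝ) ^ (-β)) hT one_pos le_rfl (by positivity)
        (by
          rw [Real.one_rpow]
          exact Real.rpow_le_one_of_one_le_of_nonpos hT1 (by linarith))
        (by simp)
        (by
          rw [one_pow, mul_one, hmul]
          exact Real.one_le_rpow hT1 (by linarith)) π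
      rwa [mul_one, hmul, ← sub_eq_add_neg] at h3
    · refine hmain _ (Real.rpow_le_rpow_of_exponent_le hT1 ?_)
      have : (α + 1) * β / D ≤ 1 := by
        rw [div_le_one hDpos, hD]
        nlinarith
      linarith
  -- The larger of the two rates is at least half of their sum, hence the constant `c / 2`.
  rcases le_total ((T : ℝ) ^ (1 - β)) ((T : ℝ) ^ (1 - (α + 1) * β / D)) with h | h
  · exact (ENNReal.ofReal_le_ofReal (by nlinarith)).trans h1
  · exact (ENNReal.ofReal_le_ofReal (by nlinarith)).trans h2
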